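/- **Setting.** Logarithms are to base 2, $H(u)=-u\log u-(1-u)\log(1-u)$, $D_{KL}(u\|p)=u\log\frac{u}{p}+(1-u)\log\frac{1-u}{1-p}$ (with $0\log 0=0$) and $[x]^+=\max(x,0)$. For each block length $N$, a word $c=(c_1,\dots,c_N)$ over a finite field $\mathbb F_m$ ($m=m_N$ may depend on $N$) is sent over the memoryless $m$-ary symmetric channel, $\Pr(r\mid c)=p$ if $r=c$ and $(1-p)/(m-1)$ otherwise, where $(1-p)/(m-1)<p<1$. The error pattern $x^N\in\{0,1\}^N$ has $x_i=1$ if the hard decision at position $i$ (the most likely symbol given $r_i$) equals $c_i$, and $x_i=0$ otherwise. In mBM-1 one chooses a set $\mathcal B_N\subseteq\{0,1\}^N$ of erasure patterns ($\hat x_i=0$: erase position $i$; $\hat x_i=1$: use the hard decision) and makes one errors-and-erasures decoding attempt per pattern, so that $|\mathcal B_N|$ is the number of decoding attempts. With $\delta(0,0)=\delta(1,0)=1$, $\delta(0,1)=2$, $\delta(1,1)=0$ and $d(x^N,\hat x^N)=\sum_i\delta(x_i,\hat x_i)$, let $$p_e(\mathcal B_N)=\Pr\Big(\min_{\hat x^N\in\mathcal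 B_N}d(x^N,\hat x^N)>D_N\Big)$$ (equal to $1$ if $\mathcal B_N=\emptyset$), where the thresholds $D_N\in\mathbb R$ satisfy $D_N/N\to\bar D$ with $1-p<\bar D\le 1$. A sequence $(\mathcal B_N)$ *achieves the exponent* $\bar F$ per symbol (total exponent $F=N\bar F$) if $p_e(\mathcal B_N)\to0$ and $\liminf_{N\to\infty}-\frac1N\log p_e(\mathcal B_N)\ge\bar F$. **Theorem 2 (minimum number of decoding attempts).** The function $g(u)=D_{KL}(u\|p)$ maps $[1-\bar D,p]$ bijectively onto $[0,D_{KL}(1-\bar D\|p)]$; let $g^{-1}$ be its inverse. Let $\bar F\in[0,D_{KL}(1-\bar D\|p)]$ and $$\bar R=\big[H(g^{-1}(\bar F))-H(g^{-1}(\bar F)+\bar D-1)\big]^+ .$$ Then the minimum number of decoding attempts with which mBM-1 achieves the exponent $\bar F$ is $2^{N\bar R}$ to first order in the exponent: 1. there are sets $\mathcal B_N$, not depending on the transmitted words, that achieve the exponent $\bar F$ for every sequence of transmitted words and satisfy, for every $\varepsilon>0$, $|\mathcal B_N|\le 2^{N(\bar R+\varepsilon)}$ for all sufficiently large $N$; 2.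 whenever sets $\mathcal B_N$ achieve the exponent $\bar F$ for some sequence of transmitted words, then for every $\varepsilon>0$, $|\mathcal B_N|\ge 2^{N(\bar R-\varepsilon)}$ for all sufficiently large $N$. -/

import Mathlib

open Filter Topology

noncomputable section

namespace MBM

/-- Binary entropy, in bits (`0 log 0 = 0`). -/
def H (u : ℝ) : ℝ := -u * Real.logb 2 u - (1 - u) * Real.logb 2 (1 - u)

/-- Binary Kullback-Leibler divergence `D_KL(u‖p)`, in bits, used for `u ∈ [0,1]`, `p ∈ (0,1)`. -/
def klBin (u p : ℝ) : ℝ :=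
  u * Real.logb 2 (u / p) + (1 - u) * Real.logb 2 ((1 - u) / (1 - p))

/-- The inverse of `u ↦ D_KL(u‖p)` on `[1 - D, p]`. -/
def gInv (D p : ℝ) : ℝ → ℝ :=
  Function.invFunOn (fun u => klBin u p) (Set.Icc (1 - D) p)

/-- Rate per symbol `[H(u) - H(u + D - 1)]⁺` at `u = g⁻¹(E)`, where `D` and `E` are the
distortion and the exponent per symbol. -/
def rate (D p E : ℝ) : ℝ := max (H (gInv D p E) - H (gInv D p E + D - 1)) 0

/-- Transition probability `Pr(r | c)` of the `m`-ary symmetric channel on the alphabet `A`,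
`m = |A|`: input `c`, output `r`. -/
def symmChannel {A : Type*} [Fintype A] [DecidableEq A] (p : ℝ) (c r : A) : ℝ :=
  if r = c then p else (1 - p) / ((Fintype.card A : ℝ) - 1)

/-- `a` is the (strictly) most likely input symbol given the channel output `r`. -/
def IsHardDecision {A : Type*} [Fintype A] [DecidableEq A] (p : ℝ) (r a : A) : Prop :=
  ∀ b, b ≠ a → symmChannel p b r < symmChannel p a r

open Classical in
/-- Error pattern: letter `1` where the hard decision is the transmitted symbol, `0` where it is
not. -/
def errorPattern {A : Type*} [Fintype A] [DecidableEq A] (p : ℝ) {N : ℕ} (c r : Fin N → A) :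
    Fin N → Fin 2 :=
  fun i => if IsHardDecision p (r i) (c i) then 1 else 0

/-- Letter distortion of mBM-1: the first argument is the error letter, the second the erasure
letter (`0` = erase, `1` = use the hard decision). -/
def letterDist : Fin 2 → Fin 2 → ℕ
  | 0, 0 => 1
  | 0, 1 => 2
  | 1, 0 => 1
  | 1, 1 => 0

/-- Distortion between an error pattern and an erasure pattern; it equals `2 v + e`, with `e` the
number of erasures and `v` the number of errors in unerased positions. -/
def dist {N : ℕ} (x y : Fin N → Fin 2) : ℕ := ∑ i, letterDist (x i) (y i)

open Classical in
/-- `p_e = Pr(min_{y ∈ B} d(x, y) > D)`: the probability, when the word `c` is sent over the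
memoryless symmetric channel, that every attempt with an erasure pattern in `B` has distortion
greater than `D`. -/
def errorProb {A : Type*} [Fintype A] [DecidableEq A] (p : ℝ) {N : ℕ} (c : Fin N → A)
    (B : Finset (Fin N → Fin 2)) (D : ℝ) : ℝ :=
  ∑ r : Fin N → A, if ∀ y ∈ B, D < (dist (errorPattern p c r) y : ℝ)
    then ∏ i, symmChannel p (c i) (r i) else 0

/-- The error probabilities tend to `0`, with exponent at least `E` per symbol:
`liminf (-(1/N) log₂ (pe N)) ≥ E` (the exponent is infinite where `pe N = 0`). -/
def AchievesExponent (pe : ℕ → ℝ) (E : ℝ) : Prop :=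
  Tendsto pe atTop (𝓝 0) ∧
    ∀ ε : ℝ, 0 < ε → ∀ᶠ N : ℕ in atTop, pe N ≤ (2 : ℝ) ^ (-((N : ℝ) * (E - ε)))

end MBM

end

/-!
Identify an error pattern `x` with its support `s = {i | x i = 1}` and an erasure pattern `y` with
`t`; then `dist x y = N - #s + #(s ∆ t)`. So the decoder fails on `s` exactly when `s` lies outside
every Hamming ball of radius `D - N + #s` around the supports `t`, and `#s` is binomial with
parameters `N` and `p`.

Let `u = g⁻¹(E)` and `s = u + D - 1`. By Chernoff's bound, failing only on supports of size below
`u * N` gives the exponent `D_KL(u‖p) = E`, and conversely the supports of size near `u * N` already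
carry probability `2 ^ (-N * E)`, so half of them must be covered. There are `2 ^ (N * H u)` of
them, and the relevant balls have radius `s * N` and volume `2 ^ (N * H s)`. This gives the lower
bound, and a greedy choice of balls shows that it is attained when the `t` have size `β * N`, where
`u = β * (1 - s) + (1 - β) * s`. When `s` exceeds `1 - u` no such `β ≤ 1` exists, but then the
all-ones pattern covers everything.
-/

namespace MBM

/-! ### Entropy and divergence -/

lemma H_eq_binEntropy_div (u : ℝ) : H u = Real.binEntropy u / Real.log 2 := by
  simp only [H, Real.logb, Real.binEntropy_eq_negMulLog_add_negMulLog_one_sub, Real.negMulLog]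
  ring

lemma continuous_H : Continuous H := by
  simp only [funext H_eq_binEntropy_div]
  fun_prop

lemma H_add_klBin {p : ℝ} (h0 : 0 < p) (h1 : p < 1) (u : ℝ) :
    H u + klBin u p = -(u * Real.logb 2 p + (1 - u) * Real.logb 2 (1 - p)) := by
  have mul_logb_div (x : ℝ) {q : ℝ} (hq : q ≠ 0) :
      x * Real.logb 2 (x / q) = x * Real.logb 2 x - x * Real.logb 2 q := by
    rcases eq_or_ne x 0 with rfl | hx
    · simp
    · rw [Real.logb_div hx hq, mul_sub]
  rw [H, klBin, mul_logb_div u h0.ne', mul_logb_div (1 - u) (sub_pos.2 h1).ne']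
  ring

lemma klBin_eq_sub_H {p : ℝ} (h0 : 0 < p) (h1 : p < 1) (u : ℝ) :
    klBin u p = -(u * Real.logb 2 p + (1 - u) * Real.logb 2 (1 - p)) - H u := by
  rw [← H_add_klBin h0 h1, add_sub_cancel_left]

lemma continuous_klBin {p : ℝ} (h0 : 0 < p) (h1 : p < 1) : Continuous fun u => klBin u p := by
  have := continuous_H
  simp only [klBin_eq_sub_H h0 h1]
  fun_prop

lemma klBin_self {p : ℝ} (h0 : 0 < p) (h1 : p < 1) : klBin p p = 0 := by
  simp [klBin, h0.ne', (sub_pos.2 h1).ne']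

lemma hasDerivAt_H {u : ℝ} (h0 : 0 < u) (h1 : u < 1) :
    HasDerivAt H (Real.logb 2 (1 - u) - Real.logb 2 u) u := by
  simp only [funext H_eq_binEntropy_div, Real.logb, ← sub_div]
  exact (Real.hasDerivAt_binEntropy h0.ne' h1.ne).div_const _

lemma hasDerivAt_klBin {p u : ℝ} (h0 : 0 < p) (h1 : p < 1) (hu0 : 0 < u) (hu1 : u < 1) :
    HasDerivAt (fun u => klBin u p)
      ((Real.logb 2 u - Real.logb 2 p) + (Real.logb 2 (1 - p) - Real.logb 2 (1 - u))) u := by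
  simp only [klBin_eq_sub_H h0 h1]
  have hlin : HasDerivAt (fun u => -(u * Real.logb 2 p + (1 - u) * Real.logb 2 (1 - p)))
      (-(1 * Real.logb 2 p + -1 * Real.logb 2 (1 - p))) u :=
    (((hasDerivAt_id u).mul_const _).add (((hasDerivAt_id u).const_sub 1).mul_const _)).neg
  exact (hlin.sub (hasDerivAt_H hu0 hu1)).congr_deriv (by ring)

lemma strictAntiOn_klBin {p : ℝ} (h0 : 0 < p) (h1 : p < 1) :
    StrictAntiOn (fun u => klBin u p) (Set.Icc 0 p) := by
  refine strictAntiOn_of_deriv_neg (convex_Icc 0 p) (continuous_klBin h0 h1).continuousOn ?_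
  intro u hu
  obtain ⟨hu0, hup⟩ := interior_Icc (a := (0 : ℝ)) ▸ hu
  rw [(hasDerivAt_klBin h0 h1 hu0 (hup.trans h1)).deriv]
  have hlog : Real.logb 2 u < Real.logb 2 p := Real.logb_lt_logb one_lt_two hu0 hup
  have hlog' : Real.logb 2 (1 - p) < Real.logb 2 (1 - u) :=
    Real.logb_lt_logb one_lt_two (by linarith) (by linarith)
  linarith

lemma klBin_pos {p u : ℝ} (h1 : p < 1) (hu : 0 ≤ u) (hup : u < p) : 0 < klBin u p := by
  have h0 : 0 < p := hu.trans_lt hup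
  have h := strictAntiOn_klBin h0 h1 ⟨hu, hup.le⟩ ⟨h0.le, le_rfl⟩ hup
  rwa [← klBin_self h0 h1]

lemma bijOn_klBin {p D : ℝ} (h0 : 0 < p) (h1 : p < 1) (hD0 : 1 - p < D) (hD1 : D ≤ 1) :
    Set.BijOn (fun u => klBin u p) (Set.Icc (1 - D) p) (Set.Icc 0 (klBin (1 - D) p)) := by
  have hle : 1 - D ≤ p := by linarith
  have hanti : StrictAntiOn (fun u => klBin u p) (Set.Icc (1 - D) p) :=
    (strictAntiOn_klBin h0 h1).mono (Set.Icc_subset_Icc_left (by linarith))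
  rw [← klBin_self h0 h1]
  exact ⟨hanti.antitoneOn.mapsTo_Icc, hanti.injOn,
    intermediate_value_Icc' hle (continuous_klBin h0 h1).continuousOn⟩

lemma gInv_mem {p D E : ℝ} (h0 : 0 < p) (h1 : p < 1) (hD0 : 1 - p < D) (hD1 : D ≤ 1)
    (hE : E ∈ Set.Icc 0 (klBin (1 - D) p)) : gInv D p E ∈ Set.Icc (1 - D) p :=
  Function.invFunOn_mem ((bijOn_klBin h0 h1 hD0 hD1).surjOn hE)

lemma klBin_gInv {p D E : ℝ} (h0 : 0 < p) (h1 : p < 1) (hD0 : 1 - p < D) (hD1 : D ≤ 1)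
    (hE : E ∈ Set.Icc 0 (klBin (1 - D) p)) : klBin (gInv D p E) p = E :=
  Function.invFunOn_eq (f := fun u => klBin u p) ((bijOn_klBin h0 h1 hD0 hD1).surjOn hE)

/-! ### Sequences growing linearly -/

/-- The sequence `f` grows linearly with slope `x`: `f N / N → x`. Block lengths, weights,
thresholds and logarithms of cardinalities are all compared with `N` in this way. -/
def HasSlope (f : ℕ → ℝ) (x : ℝ) : Prop := Tendsto (fun N : ℕ => f N / N) atTop (𝓝 x)

namespace HasSlope

variable {f g : ℕ → ℝ} {x y : ℝ}

lemma congr' (hf : HasSlope f x) (h : f =ᶠ[atTop] g) : HasSlope g x :=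
  Tendsto.congr' (h.mono fun N hN => by rw [hN]) hf

lemma add (hf : HasSlope f x) (hg : HasSlope g y) : HasSlope (fun N => f N + g N) (x + y) := by
  simpa only [HasSlope, add_div] using Tendsto.add hf hg

lemma sub (hf : HasSlope f x) (hg : HasSlope g y) : HasSlope (fun N => f N - g N) (x - y) := by
  simpa only [HasSlope, sub_div] using Tendsto.sub hf hg

lemma const_mul (c : ℝ) (hf : HasSlope f x) : HasSlope (fun N => c * f N) (c * x) := by
  simpa only [HasSlope, mul_div_assoc] using Tendsto.const_mul c hf

lemma max (hf : HasSlope f x) (hg : HasSlope g y) :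
    HasSlope (fun N => max (f N) (g N)) (max x y) := by
  simpa only [HasSlope, max_div_div_right (Nat.cast_nonneg _)] using Tendsto.max hf hg

lemma min (hf : HasSlope f x) (hg : HasSlope g y) :
    HasSlope (fun N => min (f N) (g N)) (min x y) := by
  simpa only [HasSlope, min_div_div_right (Nat.cast_nonneg _)] using Tendsto.min hf hg

lemma eventually_lt (hf : HasSlope f x) (hg : HasSlope g y) (hxy : x < y) :
    ∀ᶠ N in atTop, f N < g N := by
  filter_upwards [Tendsto.eventually_lt hf hg hxy, eventually_gt_atTop 0] with N h hN
  exact (div_lt_div_iff_of_pos_right (by positivity)).1 h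

lemma of_le_of_le {e h : ℕ → ℝ} (he : HasSlope e x) (hh : HasSlope h x)
    (hef : ∀ᶠ N in atTop, e N ≤ f N) (hfh : ∀ᶠ N in atTop, f N ≤ h N) : HasSlope f x := by
  refine tendsto_of_tendsto_of_tendsto_of_le_of_le' he hh ?_ ?_
  · filter_upwards [hef] with N hN using by gcongr
  · filter_upwards [hfh] with N hN using by gcongr

lemma natCast_mul (x : ℝ) : HasSlope (fun N => N * x) x := by
  refine tendsto_const_nhds.congr' ?_
  filter_upwards [eventually_gt_atTop 0] with N hN
  field_simp

lemma const (c : ℝ) : HasSlope (fun _ => c) 0 := tendsto_const_div_atTop_nhds_zero_nat c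

lemma natCast : HasSlope (fun N => N) 1 := by simpa using natCast_mul 1

lemma natCeil (hf : HasSlope f x) (hx : 0 ≤ x) : HasSlope (fun N => (⌈f N⌉₊ : ℝ)) x := by
  have hupper : HasSlope (fun N => Max.max (f N) 0 + 1) x := by
    simpa [max_eq_left hx] using (hf.max (const 0)).add (const 1)
  refine hf.of_le_of_le hupper (.of_forall fun N => Nat.le_ceil _) (.of_forall fun N => ?_)
  calc (⌈f N⌉₊ : ℝ) ≤ ⌈Max.max (f N) 0⌉₊ := by gcongr; exact le_max_left _ _
    _ ≤ Max.max (f N) 0 + 1 := (Nat.ceil_lt_add_one (le_max_right _ _)).le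

lemma log_natCast_add_one : HasSlope (fun N => Real.log (N + 1)) 0 := by
  have hlog : Tendsto (fun N : ℕ => Real.log (N + 1) / (N + 1 : ℝ)) atTop (𝓝 0) :=
    Real.isLittleO_log_id_atTop.tendsto_div_nhds_zero.comp
      (tendsto_atTop_add_const_right atTop 1 tendsto_natCast_atTop_atTop)
  have hratio : HasSlope (fun N => N + 1) 1 := by simpa using natCast.add (const 1)
  have hmul := hlog.mul hratio
  rw [zero_mul] at hmul
  refine hmul.congr fun N => ?_
  field_simp

end HasSlope

lemma eventually_le_two_rpow {f : ℕ → ℝ} {L R : ℝ} (hf : ∀ᶠ N in atTop, 0 < f N)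
    (hL : HasSlope (fun N => Real.log (f N)) L) (hLR : L < R * Real.log 2) :
    ∀ᶠ N : ℕ in atTop, f N ≤ 2 ^ (N * R) := by
  filter_upwards [hf, hL.eventually_lt (HasSlope.natCast_mul _) hLR] with N hpos h
  rw [Real.le_rpow_iff_log_le hpos two_pos]
  linarith

lemma exists_nat_between_hasSlope {l h : ℕ → ℕ} {x α z : ℝ} (hlh : ∀ᶠ N in atTop, l N ≤ h N)
    (hl : HasSlope (fun N => l N) x) (hh : HasSlope (fun N => h N) z) (hx : 0 ≤ x)
    (hxα : x ≤ α) (hαz : α ≤ z) :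
    ∃ a : ℕ → ℕ, (∀ᶠ N in atTop, l N ≤ a N ∧ a N ≤ h N) ∧ HasSlope (fun N => a N) α := by
  refine ⟨fun N => max (l N) (min ⌈(N : ℝ) * α⌉₊ (h N)), ?_, ?_⟩
  · filter_upwards [hlh] with N hN using ⟨le_max_left _ _, max_le hN (min_le_right _ _)⟩
  · have hceil := (HasSlope.natCast_mul α).natCeil (hx.trans hxα)
    simpa [hxα, hαz] using hl.max (hceil.min hh)

/-! ### Binomial coefficients -/

open Nat in
lemma factorial_mul_pow_le (m i : ℕ) : m ! * m ^ i ≤ i ! * m ^ m := by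
  rcases le_total m i with h | h
  · calc m ! * m ^ i = (m ! * m ^ (i - m)) * m ^ m := by
          rw [mul_assoc, ← pow_add, Nat.sub_add_cancel h]
      _ ≤ i ! * m ^ m := Nat.mul_le_mul_right _ (Nat.factorial_mul_pow_sub_le_factorial h)
  · have hdesc := Nat.factorial_mul_descFactorial (Nat.sub_le m i)
    rw [Nat.sub_sub_self h] at hdesc
    calc m ! * m ^ i = i ! * m.descFactorial (m - i) * m ^ i := by rw [hdesc]
      _ ≤ i ! * m ^ (m - i) * m ^ i := by gcongr; exact Nat.descFactorial_le_pow _ _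
      _ = i ! * m ^ m := by rw [mul_assoc, ← pow_add, Nat.sub_add_cancel h]

-- The binomial distribution with parameters `m + l` and `m / (m + l)` has its mode at `m`.
open Nat in
lemma choose_mul_pow_le_mode {m l i : ℕ} (hi : i ≤ m + l) :
    m ^ i * l ^ (m + l - i) * (m + l).choose i ≤ m ^ m * l ^ l * (m + l).choose m := by
  have hfact : 0 < (m ! * l !) * (i ! * (m + l - i)!) := by positivity
  refine Nat.le_of_mul_le_mul_right ?_ hfact
  calc _ = (m + l).choose i * i ! * (m + l - i)! *
        ((m ! * m ^ i) * (l ! * l ^ (m + l - i))) := by ring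
    _ ≤ (m + l)! * ((i ! * m ^ m) * ((m + l - i)! * l ^ l)) := by
        rw [Nat.choose_mul_factorial_mul_factorial hi]
        exact Nat.mul_le_mul_left _
          (Nat.mul_le_mul (factorial_mul_pow_le m i) (factorial_mul_pow_le l _))
    _ = _ := by
        rw [← Nat.add_choose_mul_factorial_mul_factorial m l, ← Nat.choose_symm_add]
        ring

lemma add_pow_le_choose_mul (m l : ℕ) :
    (m + l) ^ (m + l) ≤ (m + l + 1) * (m ^ m * l ^ l * (m + l).choose m) := by
  rw [add_pow]
  simpa using Finset.sum_le_card_nsmul (Finset.range (m + l + 1)) _ _ fun i hi =>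
    choose_mul_pow_le_mode (Finset.mem_range_succ_iff.1 hi)

lemma choose_mul_le_add_pow (m l : ℕ) :
    m ^ m * l ^ l * (m + l).choose m ≤ (m + l) ^ (m + l) := by
  rw [add_pow]
  simpa using Finset.single_le_sum
    (f := fun i => m ^ i * l ^ (m + l - i) * (m + l).choose i)
    (fun i _ => Nat.zero_le _) (Finset.mem_range_succ_iff.2 (Nat.le_add_right m l))

/-- The exponential growth rate, in nats per unit of `N`, of the binomial coefficient
`(β N).choose (α N)`; it equals `β h(α / β)` with `h` the binary entropy, but this form needs no
division. -/
noncomputable def chooseExponent (β α : ℝ) : ℝ :=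
  Real.negMulLog α + Real.negMulLog (β - α) - Real.negMulLog β

@[fun_prop]
lemma continuous_chooseExponent : Continuous fun z : ℝ × ℝ => chooseExponent z.1 z.2 := by
  unfold chooseExponent
  fun_prop

lemma chooseExponent_one (u : ℝ) : chooseExponent 1 u = Real.binEntropy u := by
  simp [chooseExponent, Real.binEntropy_eq_negMulLog_add_negMulLog_one_sub]

lemma chooseExponent_mul (c β α : ℝ) :
    chooseExponent (c * β) (c * α) = c * chooseExponent β α := by
  simp only [chooseExponent, ← mul_sub, Real.negMulLog_mul]
  ring

lemma exp_chooseExponent_natCast (m l : ℕ) :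
    Real.exp (chooseExponent (m + l : ℕ) m) =
      ((m + l) ^ (m + l) : ℕ) / (m ^ m * l ^ l : ℕ) := by
  have exp_mul_log_self (n : ℕ) : Real.exp (n * Real.log n) = (n : ℝ) ^ n := by
    rw [← Real.log_pow, Real.exp_log (mod_cast Nat.pow_self_pos)]
  have hexponent : chooseExponent (m + l : ℕ) m =
      (m + l : ℕ) * Real.log (m + l : ℕ) - (m * Real.log m + l * Real.log l) := by
    simp only [chooseExponent, Real.negMulLog, Nat.cast_add, add_sub_cancel_left]
    ring
  rw [hexponent, Real.exp_sub, Real.exp_add]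
  simp only [exp_mul_log_self, Nat.cast_pow, Nat.cast_mul]

lemma choose_le_exp_chooseExponent {n m : ℕ} (hmn : m ≤ n) :
    n.choose m ≤ Real.exp (chooseExponent n m) := by
  obtain ⟨l, rfl⟩ := Nat.exists_eq_add_of_le hmn
  have hpos : 0 < m ^ m * l ^ l := Nat.mul_pos Nat.pow_self_pos Nat.pow_self_pos
  rw [exp_chooseExponent_natCast, le_div_iff₀ (mod_cast hpos), mul_comm]
  exact_mod_cast choose_mul_le_add_pow m l

lemma exp_chooseExponent_le {n m : ℕ} (hmn : m ≤ n) :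
    Real.exp (chooseExponent n m) ≤ (n + 1) * n.choose m := by
  obtain ⟨l, rfl⟩ := Nat.exists_eq_add_of_le hmn
  have hpos : 0 < m ^ m * l ^ l := Nat.mul_pos Nat.pow_self_pos Nat.pow_self_pos
  rw [exp_chooseExponent_natCast, div_le_iff₀ (mod_cast hpos), mul_assoc,
    mul_comm ((m + l).choose m : ℝ)]
  exact_mod_cast add_pow_le_choose_mul m l

lemma two_rpow_H_le {N k : ℕ} (hk : k ≤ N) :
    (2 : ℝ) ^ (N * H (k / N)) ≤ (N + 1) * N.choose k := by
  rcases N.eq_zero_or_pos with rfl | hN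
  · simp [Nat.le_zero.1 hk]
  have hexponent : Real.log 2 * (N * H (k / N)) = chooseExponent N k := by
    have hscale := chooseExponent_mul N 1 (k / N)
    rw [mul_one, mul_div_cancel₀ _ (by positivity), chooseExponent_one] at hscale
    rw [hscale, H_eq_binEntropy_div]
    field_simp
  rw [Real.rpow_def_of_pos two_pos, hexponent]
  exact exp_chooseExponent_le hk

lemma HasSlope.log_choose {n m : ℕ → ℕ} {β α : ℝ} (hmn : ∀ᶠ N in atTop, m N ≤ n N)
    (hnN : ∀ᶠ N in atTop, n N ≤ N)
    (hn : HasSlope (fun N => n N) β) (hm : HasSlope (fun N => m N) α) :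
    HasSlope (fun N => Real.log ((n N).choose (m N))) (chooseExponent β α) := by
  have hexp : HasSlope (fun N => chooseExponent (n N) (m N)) (chooseExponent β α) := by
    refine ((continuous_chooseExponent.tendsto (β, α)).comp (hn.prodMk_nhds hm)).congr fun N => ?_
    simp only [Function.comp_apply, div_eq_inv_mul, chooseExponent_mul]
  have hlower : HasSlope (fun N => chooseExponent (n N) (m N) - Real.log (N + 1))
      (chooseExponent β α) := by
    simpa using hexp.sub HasSlope.log_natCast_add_one
  refine hlower.of_le_of_le hexp ?_ ?_
  · filter_upwards [hmn, hnN] with N hmn hnN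
    have h := Real.log_le_log (Real.exp_pos _) (exp_chooseExponent_le hmn)
    rw [Real.log_exp, Real.log_mul (by positivity)
      (mod_cast (Nat.choose_pos hmn).ne')] at h
    have hlog : Real.log (n N + 1) ≤ Real.log (N + 1) := by gcongr
    linarith
  · filter_upwards [hmn] with N hmn
    rw [Real.log_le_iff_le_exp (mod_cast Nat.choose_pos hmn)]
    exact choose_le_exp_chooseExponent hmn

/-! ### The binomial distribution -/

/-- The probability of `k` successes in `N` independent trials with success probability `p`; it
vanishes for `k > N`, although `N - k` is truncated there. -/
noncomputable def binomialProb (p : ℝ) (N k : ℕ) : ℝ :=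
  N.choose k * (p ^ k * (1 - p) ^ (N - k))

lemma binomialProb_nonneg {p : ℝ} (h0 : 0 ≤ p) (h1 : p ≤ 1) (N k : ℕ) :
    0 ≤ binomialProb p N k := by
  have := sub_nonneg.2 h1
  unfold binomialProb
  positivity

lemma sum_range_binomialProb (p : ℝ) (N : ℕ) :
    ∑ k ∈ Finset.range (N + 1), binomialProb p N k = 1 := by
  simpa [binomialProb, mul_comm] using (add_pow p (1 - p) N).symm

lemma sum_mul_binomialProb_le {p : ℝ} (h0 : 0 ≤ p) (h1 : p ≤ 1) {N : ℕ} {f : ℕ → ℝ}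
    (hf : ∀ k, 0 ≤ f k) (K : Finset ℕ) :
    ∑ k ∈ K, f k * binomialProb p N k ≤
      ∑ k ∈ Finset.range (N + 1), f k * binomialProb p N k := by
  have hsupport : ∀ k ∈ K, f k * binomialProb p N k ≠ 0 → k ∈ Finset.range (N + 1) := by
    intro k _ hk
    contrapose! hk
    rw [binomialProb, Nat.choose_eq_zero_of_lt (by simpa using hk)]
    simp
  rw [← Finset.sum_filter_of_ne hsupport]
  refine Finset.sum_le_sum_of_subset_of_nonneg (fun k hk => (Finset.mem_filter.1 hk).2) ?_
  exact fun k _ _ => mul_nonneg (hf k) (binomialProb_nonneg h0 h1 N k)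

lemma sum_binomialProb_le_one {p : ℝ} (h0 : 0 ≤ p) (h1 : p ≤ 1) (N : ℕ) (K : Finset ℕ) :
    ∑ k ∈ K, binomialProb p N k ≤ 1 := by
  simpa [sum_range_binomialProb] using
    sum_mul_binomialProb_le h0 h1 (N := N) (fun _ => zero_le_one) K

lemma pow_mul_pow_eq_two_rpow {p : ℝ} (h0 : 0 < p) (h1 : p < 1) {N k : ℕ} (hk : k ≤ N) :
    p ^ k * (1 - p) ^ (N - k) =
      2 ^ (k * Real.logb 2 p + (N - k) * Real.logb 2 (1 - p)) := by
  have two_rpow_mul_logb {q : ℝ} (hq : 0 < q) (n : ℕ) : (2 : ℝ) ^ (n * Real.logb 2 q) = q ^ n := by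
    rw [mul_comm, Real.rpow_mul two_pos.le, Real.rpow_logb two_pos (by norm_num) hq,
      Real.rpow_natCast]
  rw [Real.rpow_add two_pos, ← Nat.cast_sub hk, two_rpow_mul_logb h0,
    two_rpow_mul_logb (sub_pos.2 h1)]

/-- Exponential tilting from success probability `p` to `v`. -/
lemma pow_mul_pow_le_two_rpow_mul {p v : ℝ} (h1 : p < 1) (hv : 0 < v) (hvp : v ≤ p) {N k : ℕ}
    (hkN : k ≤ N) (hk : k ≤ N * v) :
    p ^ k * (1 - p) ^ (N - k) ≤ 2 ^ (-(N * klBin v p)) * (v ^ k * (1 - v) ^ (N - k)) := by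
  have h0 : 0 < p := hv.trans_le hvp
  have hv1 : v < 1 := hvp.trans_lt h1
  rw [pow_mul_pow_eq_two_rpow h0 h1 hkN, pow_mul_pow_eq_two_rpow hv hv1 hkN,
    ← Real.rpow_add two_pos]
  refine Real.rpow_le_rpow_of_exponent_le one_le_two ?_
  have hlog : Real.logb 2 v ≤ Real.logb 2 p := Real.logb_le_logb_of_le one_lt_two hv hvp
  have hlog' : Real.logb 2 (1 - p) ≤ Real.logb 2 (1 - v) :=
    Real.logb_le_logb_of_le one_lt_two (by linarith) (by linarith)
  have htilt := mul_nonneg (sub_nonneg.2 hk) (add_nonneg (sub_nonneg.2 hlog) (sub_nonneg.2 hlog'))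
  rw [klBin_eq_sub_H h0 h1, H]
  linarith

lemma sum_binomialProb_le_two_rpow {p v : ℝ} (h1 : p < 1) (hv : 0 < v) (hvp : v ≤ p) {N : ℕ}
    {K : Finset ℕ} (hK : ∀ k ∈ K, k ≤ N * v) :
    ∑ k ∈ K, binomialProb p N k ≤ 2 ^ (-(N * klBin v p)) := by
  calc ∑ k ∈ K, binomialProb p N k
      ≤ ∑ k ∈ K, 2 ^ (-(N * klBin v p)) * binomialProb v N k := by
        refine Finset.sum_le_sum fun k hk => ?_
        rcases le_or_gt k N with hkN | hkN
        · rw [binomialProb, binomialProb, mul_left_comm (2 ^ _ : ℝ)]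
          exact mul_le_mul_of_nonneg_left
            (pow_mul_pow_le_two_rpow_mul h1 hv hvp hkN (hK k hk)) (Nat.cast_nonneg _)
        · simp [binomialProb, Nat.choose_eq_zero_of_lt hkN]
    _ ≤ 2 ^ (-(N * klBin v p)) := by
        rw [← Finset.mul_sum]
        exact mul_le_of_le_one_right (by positivity)
          (sum_binomialProb_le_one hv.le (hvp.trans h1.le) N K)

lemma klBin_half (v : ℝ) : klBin v 2⁻¹ = 1 - H v := by
  have hlogb : Real.logb 2 (2⁻¹ : ℝ) = -1 := by simp
  rw [klBin_eq_sub_H (by norm_num) (by norm_num), show (1 : ℝ) - 2⁻¹ = 2⁻¹ by norm_num, hlogb]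
  ring

lemma sum_choose_le_two_rpow {v : ℝ} (hv : 0 < v) (hv' : v ≤ 2⁻¹) {N : ℕ} {K : Finset ℕ}
    (hK : ∀ k ∈ K, k ≤ N * v) :
    ∑ k ∈ K, (N.choose k : ℝ) ≤ 2 ^ (N * H v) := by
  have hhalf (k : ℕ) : binomialProb 2⁻¹ N k = N.choose k * 2 ^ (-N : ℝ) := by
    rcases le_or_gt k N with hkN | hkN
    · rw [binomialProb, show (1 : ℝ) - 2⁻¹ = 2⁻¹ by norm_num, ← pow_add, Nat.add_sub_of_le hkN,
        inv_pow, Real.rpow_neg two_pos.le, Real.rpow_natCast]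
    · simp [binomialProb, Nat.choose_eq_zero_of_lt hkN]
  have hchernoff := sum_binomialProb_le_two_rpow (by norm_num) hv hv' hK
  simp only [hhalf, ← Finset.sum_mul, klBin_half] at hchernoff
  rw [show -(N * (1 - H v)) = N * H v + -N by ring, Real.rpow_add two_pos] at hchernoff
  exact le_of_mul_le_mul_right hchernoff (by positivity)

lemma two_rpow_neg_klBin_le {p : ℝ} (h0 : 0 < p) (h1 : p < 1) {N k : ℕ} (hk : k ≤ N) :
    2 ^ (-(N * klBin (k / N) p)) ≤ (N + 1) * binomialProb p N k := by
  have hweight : p ^ k * (1 - p) ^ (N - k) =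
      2 ^ (-(N * (H (k / N) + klBin (k / N) p))) := by
    rw [pow_mul_pow_eq_two_rpow h0 h1 hk, H_add_klBin h0 h1]
    rcases N.eq_zero_or_pos with rfl | hN
    · simp [Nat.le_zero.1 hk]
    · field_simp
  rw [binomialProb, ← mul_assoc, hweight]
  calc (2 : ℝ) ^ (-(N * klBin (k / N) p))
      = 2 ^ (N * H (k / N)) * 2 ^ (-(N * (H (k / N) + klBin (k / N) p))) := by
        rw [← Real.rpow_add two_pos]
        ring_nf
    _ ≤ _ := by gcongr; exact two_rpow_H_le hk

lemma sum_binomialProb_le_variance_div {p : ℝ} (h0 : 0 ≤ p) (h1 : p ≤ 1) {N : ℕ} {K : Finset ℕ}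
    {a : ℝ} (ha : 0 < a) (hK : ∀ k ∈ K, a ≤ |N * p - k|) :
    ∑ k ∈ K, binomialProb p N k ≤ N * (p * (1 - p)) / a ^ 2 := by
  have hvariance : ∑ k ∈ Finset.range (N + 1), (N * p - k) ^ 2 * binomialProb p N k =
      N * (p * (1 - p)) := by
    simpa [Polynomial.eval_finsetSum, bernsteinPolynomial, binomialProb, mul_assoc] using
      congrArg (Polynomial.eval p) (bernsteinPolynomial.variance ℝ N)
  rw [le_div_iff₀ (by positivity), Finset.sum_mul, ← hvariance]
  refine le_trans (Finset.sum_le_sum fun k hk => ?_)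
    (sum_mul_binomialProb_le h0 h1 (fun k => sq_nonneg _) K)
  rw [mul_comm, ← sq_abs (N * p - k)]
  gcongr
  · exact binomialProb_nonneg h0 h1 N k
  · exact hK k hk

/-! ### Distortion and error probability in terms of supports -/

/-- The support of a binary pattern, that is, the positions of its letters `1`. It identifies
patterns with subsets of `Fin N`, on which the counting is done. -/
def ones {N : ℕ} : (Fin N → Fin 2) ≃ Finset (Fin N) where
  toFun x := {i | x i = 1}
  invFun s i := if i ∈ s then 1 else 0
  left_inv x := by
    ext i
    obtain h | h : x i = 0 ∨ x i = 1 := by lia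
    all_goals simp [h]
  right_inv s := by ext i; simp

lemma mem_ones {N : ℕ} {x : Fin N → Fin 2} {i : Fin N} : i ∈ ones x ↔ x i = 1 := by
  simp [ones]

open scoped symmDiff

lemma dist_add_card_ones {N : ℕ} (x y : Fin N → Fin 2) :
    dist x y + (ones x).card = N + (ones x ∆ ones y).card := by
  have hletter : ∀ a b : Fin 2,
      letterDist a b + (if a = 1 then 1 else 0) = 1 + if a ≠ b then 1 else 0 := by decide
  have hones : (ones x).card = ∑ i, if x i = 1 then 1 else 0 := Finset.card_filter _ _
  have hdiff : (ones x ∆ ones y).card = ∑ i, if x i ≠ y i then 1 else 0 := by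
    rw [← Finset.card_filter]
    congr 1
    ext i
    rw [Finset.mem_symmDiff, mem_ones, mem_ones, Finset.mem_filter_univ]
    lia
  rw [dist, hones, hdiff, ← Finset.sum_add_distrib]
  simp only [hletter, Finset.sum_add_distrib]
  simp

lemma card_symmDiff_add {α : Type*} [DecidableEq α] (s t : Finset α) :
    (s ∆ t).card + 2 * (s ∩ t).card = s.card + t.card := by
  have hunion : (s ∆ t).card = (s \ t).card + (t \ s).card :=
    Finset.card_union_of_disjoint disjoint_sdiff_sdiff
  have hs := Finset.card_sdiff_add_card_inter s t
  have ht := Finset.card_sdiff_add_card_inter t s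
  rw [Finset.inter_comm t s] at ht
  lia

open Classical in
/-- The supports of the error patterns that no erasure pattern in `B` brings within distortion
`D`: such a pattern `x` has `d(x, y) = N - |x| + |x ∆ y| > D` for all `y ∈ B`. -/
noncomputable def uncovered {N : ℕ} (B : Finset (Fin N → Fin 2)) (D : ℝ) :
    Finset (Finset (Fin N)) :=
  {s | ∀ y ∈ B, D < N - s.card + (s ∆ ones y).card}

lemma ones_mem_uncovered {N : ℕ} {B : Finset (Fin N → Fin 2)} {D : ℝ} {x : Fin N → Fin 2} :
    ones x ∈ uncovered B D ↔ ∀ y ∈ B, D < dist x y := by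
  rw [uncovered, Finset.mem_filter_univ]
  refine forall₂_congr fun y _ => ?_
  have h : (dist x y + (ones x).card : ℝ) = N + (ones x ∆ ones y).card :=
    mod_cast dist_add_card_ones x y
  rw [← sub_eq_iff_eq_add.2 h.symm, sub_add_eq_add_sub]

section Channel

variable {A : Type*} [Fintype A] [DecidableEq A] {p : ℝ}

lemma isHardDecision_iff (hpm : (1 - p) / ((Fintype.card A : ℝ) - 1) < p) {r a : A} :
    IsHardDecision p r a ↔ r = a := by
  refine ⟨fun h => ?_, ?_⟩
  · by_contra hne
    have hlt := h r hne
    rw [symmChannel, symmChannel, if_pos rfl, if_neg hne] at hlt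
    exact hlt.not_gt hpm
  · rintro rfl b hb
    rwa [symmChannel, symmChannel, if_pos rfl, if_neg hb.symm]

variable [Nontrivial A]

lemma sum_symmChannel (p : ℝ) (c : A) (b : Fin 2) :
    ∑ r with (if r = c then 1 else 0) = b, symmChannel p c r = if b = 1 then p else 1 - p := by
  obtain rfl | rfl : b = 0 ∨ b = 1 := by lia
  · have hcard : (Fintype.card A : ℝ) - 1 ≠ 0 :=
      sub_ne_zero.2 (mod_cast Fintype.one_lt_card.ne')
    have herror : ∀ r ∈ Finset.univ.erase c,
        symmChannel p c r = (1 - p) / ((Fintype.card A : ℝ) - 1) :=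
      fun r hr => if_neg (Finset.ne_of_mem_erase hr)
    have hfilter : Finset.univ.filter (fun r => (if r = c then 1 else 0) = (0 : Fin 2)) =
        Finset.univ.erase c := by
      ext r; simp
    rw [hfilter, Finset.sum_congr rfl herror, Finset.sum_const, Finset.card_erase_of_mem
      (Finset.mem_univ c), Finset.card_univ, nsmul_eq_mul, Nat.cast_pred Fintype.card_pos,
      mul_div_cancel₀ _ hcard, if_neg (by decide)]
  · simp [symmChannel, Finset.sum_filter]

lemma sum_errorPattern (hpm : (1 - p) / ((Fintype.card A : ℝ) - 1) < p) {N : ℕ}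
    (c : Fin N → A) (x : Fin N → Fin 2) :
    ∑ r with errorPattern p c r = x, ∏ i, symmChannel p (c i) (r i) =
      p ^ (ones x).card * (1 - p) ^ (N - (ones x).card) := by
  have hfiber : Finset.univ.filter (fun r => errorPattern p c r = x) =
      Fintype.piFinset fun i => {r | (if r = c i then 1 else 0) = x i} := by
    ext r
    simp [errorPattern, isHardDecision_iff hpm, funext_iff]
  have hcompl : Finset.univ.filter (fun i => ¬ x i = 1) = (ones x)ᶜ := by
    ext i; simp [mem_ones]
  rw [hfiber, ← Finset.prod_univ_sum]
  simp only [sum_symmChannel]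
  rw [Finset.prod_ite, Finset.prod_const, Finset.prod_const, hcompl, Finset.card_compl,
    Fintype.card_fin]
  rfl

variable {N : ℕ} {B : Finset (Fin N → Fin 2)} {D : ℝ}

lemma errorProb_eq_sum_uncovered (hpm : (1 - p) / ((Fintype.card A : ℝ) - 1) < p)
    (c : Fin N → A) :
    errorProb p c B D = ∑ s ∈ uncovered B D, p ^ s.card * (1 - p) ^ (N - s.card) := by
  classical
  have huncovered : ∑ s ∈ uncovered B D, p ^ s.card * (1 - p) ^ (N - s.card) =
      ∑ x with ∀ y ∈ B, D < (dist x y : ℝ), p ^ (ones x).card * (1 - p) ^ (N - (ones x).card) := by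
    refine (Finset.sum_equiv ones (fun x => ?_) fun x _ => rfl).symm
    rw [ones_mem_uncovered, Finset.mem_filter_univ]
  rw [huncovered, errorProb, ← Finset.sum_filter]
  simp only [← sum_errorPattern hpm c]
  rw [Finset.sum_fiberwise_eq_sum_filter]
  simp only [Finset.mem_filter_univ]

lemma errorProb_nonneg (h0 : 0 ≤ p) (h1 : p ≤ 1)
    (hpm : (1 - p) / ((Fintype.card A : ℝ) - 1) < p) (c : Fin N → A) :
    0 ≤ errorProb p c B D := by
  have := sub_nonneg.2 h1
  rw [errorProb_eq_sum_uncovered hpm]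
  positivity

lemma errorProb_empty (hpm : (1 - p) / ((Fintype.card A : ℝ) - 1) < p) (c : Fin N → A) :
    errorProb p c ∅ D = 1 := by
  simpa [errorProb_eq_sum_uncovered hpm, uncovered] using
    Fintype.sum_pow_mul_eq_add_pow (Fin N) p (1 - p)

lemma errorProb_le_sum_binomialProb (h0 : 0 ≤ p) (h1 : p ≤ 1)
    (hpm : (1 - p) / ((Fintype.card A : ℝ) - 1) < p) (c : Fin N → A) {K : Finset ℕ}
    (hK : ∀ s ∈ uncovered B D, s.card ∈ K) :
    errorProb p c B D ≤ ∑ k ∈ K, binomialProb p N k := by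
  have := sub_nonneg.2 h1
  rw [errorProb_eq_sum_uncovered hpm,
    ← Finset.sum_fiberwise_of_maps_to' hK fun k => p ^ k * (1 - p) ^ (N - k)]
  refine Finset.sum_le_sum fun k _ => ?_
  rw [Finset.sum_const, nsmul_eq_mul, binomialProb]
  gcongr
  exact (Finset.sized_slice.card_le).trans_eq (by rw [Fintype.card_fin])

lemma sum_binomialProb_div_two_le_errorProb (h0 : 0 ≤ p) (h1 : p ≤ 1)
    (hpm : (1 - p) / ((Fintype.card A : ℝ) - 1) < p) (c : Fin N → A) {K : Finset ℕ}
    (hK : ∀ k ∈ K, (N.choose k : ℝ) / 2 ≤ ((uncovered B D).slice k).card) :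
    (∑ k ∈ K, binomialProb p N k) / 2 ≤ errorProb p c B D := by
  have := sub_nonneg.2 h1
  calc (∑ k ∈ K, binomialProb p N k) / 2
      ≤ ∑ k ∈ K, ((uncovered B D).slice k).card * (p ^ k * (1 - p) ^ (N - k)) := by
        rw [Finset.sum_div]
        refine Finset.sum_le_sum fun k hk => ?_
        rw [binomialProb, mul_div_right_comm]
        gcongr
        exact hK k hk
    _ = ∑ s ∈ uncovered B D with s.card ∈ K, p ^ s.card * (1 - p) ^ (N - s.card) := by
        rw [← Finset.sum_fiberwise_eq_sum_filter' _ _ _ fun k => p ^ k * (1 - p) ^ (N - k)]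
        simp only [Finset.sum_const, nsmul_eq_mul]
        rfl
    _ ≤ errorProb p c B D := by
        rw [errorProb_eq_sum_uncovered hpm]
        exact Finset.sum_le_sum_of_subset_of_nonneg (Finset.filter_subset _ _)
          fun _ _ _ => by positivity

end Channel

lemma card_hammingBall_le {v : ℝ} (hv : 0 < v) (hv' : v ≤ 2⁻¹) {N : ℕ} (t : Finset (Fin N)) :
    (Finset.card {s : Finset (Fin N) | ((s ∆ t).card : ℝ) ≤ N * v} : ℝ) ≤ 2 ^ (N * H v) := by
  have hmaps : Set.MapsTo (fun s => (s ∆ t).card)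
      (Finset.univ.filter fun s : Finset (Fin N) => ((s ∆ t).card : ℝ) ≤ N * v)
      (Finset.range (⌊N * v⌋₊ + 1)) := by
    intro s hs
    rw [Finset.coe_filter_univ] at hs
    exact Finset.mem_coe.2 (Finset.mem_range_succ_iff.2 (Nat.le_floor hs))
  have hshell (k : ℕ) : Finset.card {s : Finset (Fin N) | (s ∆ t).card = k} ≤ N.choose k := by
    calc _ ≤ (Finset.powersetCard k (Finset.univ : Finset (Fin N))).card :=
          Finset.card_le_card_of_injOn (· ∆ t) (fun s hs => by simpa using hs)
            (symmDiff_left_injective t).injOn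
      _ = N.choose k := by simp
  refine le_trans ?_ (sum_choose_le_two_rpow hv hv' (N := N) (K := Finset.range (⌊N * v⌋₊ + 1)) ?_)
  · rw [Finset.card_eq_sum_card_fiberwise hmaps, Nat.cast_sum]
    gcongr with k
    refine (Finset.card_le_card ?_).trans (hshell k)
    rw [Finset.filter_filter]
    exact Finset.monotone_filter_right _ fun s _ hs => hs.2
  · intro k hk
    exact (Nat.le_floor_iff (by positivity)).1 (Finset.mem_range_succ_iff.1 hk)

-- `D + k - N` is the Hamming distance at which a pattern covers supports of size `k`.
lemma choose_sub_le_card_slice_uncovered {v : ℝ} (hv : 0 < v) (hv' : v ≤ 2⁻¹) {N : ℕ}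
    (B : Finset (Fin N → Fin 2)) {D : ℝ} {k : ℕ} (hk : D + k - N ≤ N * v) :
    N.choose k - B.card * 2 ^ (N * H v) ≤ (((uncovered B D).slice k).card : ℝ) := by
  classical
  let ball (y : Fin N → Fin 2) : Finset (Finset (Fin N)) :=
    {s | ((s ∆ ones y).card : ℝ) ≤ N * v}
  have hsubset : Finset.powersetCard k Finset.univ ⊆ (uncovered B D).slice k ∪ B.biUnion ball := by
    intro s hs
    obtain rfl : s.card = k := (Finset.mem_powersetCard.1 hs).2
    by_cases h : s ∈ uncovered B D
    · exact Finset.mem_union_left _ (Finset.mem_slice.2 ⟨h, rfl⟩)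
    · rw [uncovered, Finset.mem_filter_univ] at h
      push Not at h
      obtain ⟨y, hy, hsy⟩ := h
      refine Finset.mem_union_right _ (Finset.mem_biUnion.2 ⟨y, hy, ?_⟩)
      rw [Finset.mem_filter_univ]
      linarith
  have hballs : ((B.biUnion ball).card : ℝ) ≤ B.card * 2 ^ (N * H v) := by
    calc ((B.biUnion ball).card : ℝ) ≤ ∑ y ∈ B, ((ball y).card : ℝ) :=
          mod_cast Finset.card_biUnion_le
      _ ≤ B.card * 2 ^ (N * H v) := by
          rw [← nsmul_eq_mul]
          exact Finset.sum_le_card_nsmul _ _ _ fun y _ => card_hammingBall_le hv hv' (ones y)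
  have hcard := (Finset.card_le_card hsubset).trans (Finset.card_union_le _ _)
  rw [Finset.card_powersetCard, Finset.card_univ, Fintype.card_fin] at hcard
  have hcard' : (N.choose k : ℝ) ≤ ((uncovered B D).slice k).card + (B.biUnion ball).card :=
    mod_cast hcard
  linarith

/-! ### Greedy covering -/

section GreedyCover

variable {α β : Type*} {r : α → β → Prop} [DecidableRel r] {q : ℝ} {Y : Finset β}

lemma exists_card_filter_not_le (hY : Y.Nonempty) (U : Finset α)
    (hU : ∀ x ∈ U, q * Y.card ≤ Finset.card {y ∈ Y | r x y}) :
    ∃ y ∈ Y, (Finset.card {x ∈ U | ¬ r x y} : ℝ) ≤ (1 - q) * U.card := by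
  have hsum : U.card * (q * Y.card) ≤ ∑ y ∈ Y, (Finset.card {x ∈ U | r x y} : ℝ) := by
    calc U.card * (q * Y.card) ≤ ∑ x ∈ U, (Finset.card {y ∈ Y | r x y} : ℝ) := by
          rw [← nsmul_eq_mul]
          exact Finset.card_nsmul_le_sum _ _ _ hU
      _ = ∑ y ∈ Y, (Finset.card {x ∈ U | r x y} : ℝ) :=
          mod_cast Finset.sum_card_bipartiteAbove_eq_sum_card_bipartiteBelow r
  obtain ⟨y, hy, hcovered⟩ : ∃ y ∈ Y, q * U.card ≤ Finset.card {x ∈ U | r x y} := by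
    refine Finset.exists_le_of_sum_le hY (le_trans (le_of_eq ?_) hsum)
    rw [Finset.sum_const, nsmul_eq_mul]
    ring
  have hsplit : (Finset.card {x ∈ U | r x y} + Finset.card {x ∈ U | ¬ r x y} : ℝ) = U.card :=
    mod_cast Finset.card_filter_add_card_filter_not _
  exact ⟨y, hy, by linarith⟩

lemma exists_card_not_covered_le (hY : Y.Nonempty) (X : Finset α)
    (hX : ∀ x ∈ X, q * Y.card ≤ Finset.card {y ∈ Y | r x y}) (n : ℕ) :
    ∃ B ⊆ Y, B.card ≤ n ∧
      (Finset.card {x ∈ X | ∀ y ∈ B, ¬ r x y} : ℝ) ≤ X.card * Real.exp (-(n * q)) := by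
  classical
  induction n with
  | zero => exact ⟨∅, by simp⟩
  | succ n ih =>
    obtain ⟨B, hBY, hBn, hB⟩ := ih
    obtain ⟨y, hy, hremaining⟩ := exists_card_filter_not_le hY {x ∈ X | ∀ y ∈ B, ¬ r x y}
      fun x hx => hX x (Finset.mem_filter.1 hx).1
    refine ⟨insert y B, Finset.insert_subset hy hBY,
      (Finset.card_insert_le _ _).trans (Nat.succ_le_succ hBn), ?_⟩
    have hinsert : {x ∈ X | ∀ z ∈ insert y B, ¬ r x z} =
        Finset.filter (fun x => ¬ r x y) {x ∈ X | ∀ y ∈ B, ¬ r x y} := by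
      rw [Finset.filter_filter]
      exact Finset.filter_congr fun x _ => by rw [Finset.forall_mem_insert, and_comm]
    rw [hinsert]
    calc _ ≤ (1 - q) * (Finset.card {x ∈ X | ∀ y ∈ B, ¬ r x y} : ℝ) := hremaining
      _ ≤ Real.exp (-q) * (X.card * Real.exp (-(n * q))) := by
          gcongr
          exact Real.one_sub_le_exp_neg q
      _ = X.card * Real.exp (-((n + 1 : ℕ) * q)) := by
          rw [mul_left_comm, ← Real.exp_add]
          push_cast
          ring_nf

lemma exists_cover (hY : Y.Nonempty) {X : Finset α}
    (hX : ∀ x ∈ X, q * Y.card ≤ Finset.card {y ∈ Y | r x y}) {n : ℕ}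
    (hn : X.card * Real.exp (-(n * q)) < 1) :
    ∃ B ⊆ Y, B.card ≤ n ∧ ∀ x ∈ X, ∃ y ∈ B, r x y := by
  obtain ⟨B, hBY, hBn, hB⟩ := exists_card_not_covered_le hY X hX n
  have hempty : {x ∈ X | ∀ y ∈ B, ¬ r x y} = ∅ :=
    Finset.card_eq_zero.1 (Nat.lt_one_iff.1 (mod_cast hB.trans_lt hn))
  refine ⟨B, hBY, hBn, fun x hx => ?_⟩
  simpa using Finset.filter_eq_empty_iff.1 hempty hx

end GreedyCover

lemma choose_mul_choose_le_card_overlap {α : Type*} [Fintype α] [DecidableEq α] {a j : ℕ}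
    (haj : a ≤ j) (s : Finset α) :
    s.card.choose a * (Fintype.card α - s.card).choose (j - a) ≤
      Finset.card {t ∈ Finset.powersetCard j Finset.univ | a ≤ (s ∩ t).card} := by
  rw [← Finset.card_compl, ← Finset.card_powersetCard, ← Finset.card_powersetCard,
    ← Finset.card_product]
  have hinter {P Q : Finset α} (hP : P ⊆ s) (hQ : Q ⊆ sᶜ) : s ∩ (P ∪ Q) = P := by
    rw [Finset.inter_union_distrib_left, Finset.inter_eq_right.2 hP,
      Finset.disjoint_iff_inter_eq_empty.1 (disjoint_compl_right.mono_right hQ),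
      Finset.union_empty]
  have hinter' {P Q : Finset α} (hP : P ⊆ s) (hQ : Q ⊆ sᶜ) : sᶜ ∩ (P ∪ Q) = Q := by
    rw [Finset.inter_union_distrib_left, Finset.inter_eq_right.2 hQ,
      Finset.disjoint_iff_inter_eq_empty.1 (disjoint_compl_left.mono_right hP),
      Finset.empty_union]
  refine Finset.card_le_card_of_injOn (fun z => z.1 ∪ z.2) ?_ ?_
  · rintro ⟨P, Q⟩ hPQ
    simp only [Finset.mem_coe, Finset.mem_product, Finset.mem_powersetCard] at hPQ
    obtain ⟨⟨hP, hPa⟩, hQ, hQa⟩ := hPQ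
    have hdisj : Disjoint P Q := disjoint_compl_right.mono hP hQ
    rw [Finset.mem_coe, Finset.mem_filter, Finset.mem_powersetCard, hinter hP hQ,
      Finset.card_union_of_disjoint hdisj]
    exact ⟨⟨Finset.subset_univ _, by lia⟩, hPa.ge⟩
  · rintro ⟨P, Q⟩ hPQ ⟨P', Q'⟩ hPQ' heq
    simp only [Finset.mem_coe, Finset.mem_product, Finset.mem_powersetCard] at hPQ hPQ' heq
    have hP := hinter hPQ.1.1 hPQ.2.1
    have hQ := hinter' hPQ.1.1 hPQ.2.1
    rw [heq] at hP hQ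
    exact Prod.ext (hP.symm.trans (hinter hPQ'.1.1 hPQ'.2.1))
      (hQ.symm.trans (hinter' hPQ'.1.1 hPQ'.2.1))

lemma two_pow_mul_exp_neg_lt_one {N : ℕ} (hN : 0 < N) : (2 : ℝ) ^ N * Real.exp (-N) < 1 := by
  have hbase : 2 * Real.exp (-1) < 1 := by
    rw [Real.exp_neg, ← div_eq_mul_inv, div_lt_one (Real.exp_pos 1)]
    linarith [Real.exp_one_gt_d9]
  calc (2 : ℝ) ^ N * Real.exp (-N) = (2 * Real.exp (-1)) ^ N := by
        rw [mul_pow, ← Real.exp_nat_mul, mul_neg_one]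
    _ < 1 := pow_lt_one₀ (by positivity) hbase hN.ne'

-- Uniformly random `j`-subsets meet a fixed `k`-subset in `a` or more elements with
-- probability at least `k.choose a * (N - k).choose (j - a) / N.choose j`.
lemma exists_overlap_cover {N k j a n : ℕ} (hN : 0 < N) (hjN : j ≤ N) (haj : a ≤ j)
    (hn : N * N.choose j ≤ n * (k.choose a * (N - k).choose (j - a))) :
    ∃ B : Finset (Finset (Fin N)), B.card ≤ n ∧
      ∀ s : Finset (Fin N), k ≤ s.card → ∃ t ∈ B, t.card = j ∧ a ≤ (s ∩ t).card := by
  have hchoose : (0 : ℝ) < N.choose j := mod_cast Nat.choose_pos hjN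
  have hY : (Finset.powersetCard j (Finset.univ : Finset (Fin N))).Nonempty :=
    Finset.powersetCard_nonempty.2 (by simpa using hjN)
  have hX : ∀ s ∈ Finset.powersetCard k (Finset.univ : Finset (Fin N)),
      ((k.choose a * (N - k).choose (j - a) : ℕ) / N.choose j : ℝ) *
          (Finset.powersetCard j (Finset.univ : Finset (Fin N))).card ≤
        Finset.card {t ∈ Finset.powersetCard j Finset.univ | a ≤ (s ∩ t).card} := by
    intro s hs
    rw [Finset.card_powersetCard, Finset.card_univ, Fintype.card_fin,
      div_mul_cancel₀ _ hchoose.ne', Nat.cast_le]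
    simpa [(Finset.mem_powersetCard.1 hs).2] using choose_mul_choose_le_card_overlap haj s
  obtain ⟨B, hBY, hBn, hB⟩ := exists_cover hY hX (n := n) <| by
    have hcard : ((Finset.powersetCard k (Finset.univ : Finset (Fin N))).card : ℝ) ≤ 2 ^ N := by
      simpa using mod_cast Nat.choose_le_two_pow N k
    refine lt_of_le_of_lt ?_ (two_pow_mul_exp_neg_lt_one hN)
    gcongr
    rw [← mul_div_assoc, le_div_iff₀ hchoose]
    exact_mod_cast hn
  refine ⟨B, hBn, fun s hs => ?_⟩
  obtain ⟨s', hs's, hs'⟩ := Finset.exists_subset_card_eq hs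
  obtain ⟨t, ht, hat⟩ := hB s' (Finset.mem_powersetCard.2 ⟨Finset.subset_univ _, hs'⟩)
  exact ⟨t, ht, (Finset.mem_powersetCard.1 (hBY ht)).2,
    hat.trans (Finset.card_le_card (Finset.inter_subset_inter_right hs's))⟩

lemma exists_forall_mem_uncovered_card_lt {N k j a n : ℕ} {D : ℝ} (hN : 0 < N) (hjN : j ≤ N)
    (haj : a ≤ j) (hn : N * N.choose j ≤ n * (k.choose a * (N - k).choose (j - a)))
    (hD : (N : ℝ) + j - 2 * a ≤ D) :
    ∃ B : Finset (Fin N → Fin 2), B.card ≤ n ∧ ∀ s ∈ uncovered B D, s.card < k := by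
  obtain ⟨B, hBn, hB⟩ := exists_overlap_cover hN hjN haj hn
  refine ⟨B.map ones.symm.toEmbedding, by simpa using hBn, fun s hs => ?_⟩
  by_contra! hks
  obtain ⟨t, ht, rfl, hat⟩ := hB s hks
  rw [uncovered, Finset.mem_filter_univ] at hs
  have hdist := hs (ones.symm t) (Finset.mem_map_of_mem _ ht)
  rw [Equiv.apply_symm_apply] at hdist
  have hsymm : ((symmDiff s t).card + 2 * (s ∩ t).card : ℝ) = s.card + t.card :=
    mod_cast card_symmDiff_add s t
  have hat' : (a : ℝ) ≤ (s ∩ t).card := mod_cast hat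
  linarith

/-! ### Covering at linear scale -/

/-- The exponential rate, in nats, at which the probability that a random set of `β * N` elements
meets a fixed set of `u * N` elements in `α * N` elements decays in an `N`-element set. -/
noncomputable def overlapExponent (u β α : ℝ) : ℝ :=
  chooseExponent 1 β - (chooseExponent u α + chooseExponent (1 - u) (β - α))

lemma overlapExponent_one_self (u : ℝ) : overlapExponent u 1 u = 0 := by
  simp [overlapExponent, chooseExponent]

-- A binary symmetric channel with crossover probability `s` turns input weight `β` into output
-- weight `u`, with overlap `β * (1 - s)`; its mutual information is the overlap exponent.
lemma overlapExponent_mul_one_sub (β s : ℝ) :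
    overlapExponent (β * (1 - s) + (1 - β) * s) β (β * (1 - s)) =
      Real.binEntropy (β * (1 - s) + (1 - β) * s) - Real.binEntropy s := by
  have h10 : β * (1 - s) + (1 - β) * s - β * (1 - s) = (1 - β) * s := by ring
  have h01 : β - β * (1 - s) = β * s := by ring
  have h00 : 1 - (β * (1 - s) + (1 - β) * s) - β * s = (1 - β) * (1 - s) := by ring
  simp only [overlapExponent, chooseExponent, h10, h01, h00,
    Real.binEntropy_eq_negMulLog_add_negMulLog_one_sub, Real.negMulLog_mul, Real.negMulLog_one]
  ring

lemma choose_mul_choose_le (m n i j : ℕ) :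
    m.choose i * n.choose j ≤ (m + n).choose (i + j) := by
  rw [Nat.add_choose_eq]
  exact Finset.single_le_sum (f := fun ij : ℕ × ℕ => m.choose ij.1 * n.choose ij.2)
    (fun _ _ => Nat.zero_le _) (Finset.HasAntidiagonal.mem_antidiagonal.2 rfl : (i, j) ∈ _)

/-- Weights `k` of the patterns to be covered, `j` of the covering patterns, and `a` of their
overlaps are compatible at block length `N`: some pair of patterns realises them, and such a pair
is within distortion `D`. -/
structure IsOverlap (N k j a : ℕ) (D : ℝ) : Prop where
  overlap_le_left : a ≤ k
  overlap_le_right : a ≤ j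
  right_le : j ≤ N
  left_le : k ≤ N
  union_le : j - a ≤ N - k
  distortion_le : (N : ℝ) + j - 2 * a ≤ D

namespace IsOverlap

variable {N k j a : ℕ} {D : ℝ}

lemma choose_mul_choose_pos (h : IsOverlap N k j a D) :
    0 < k.choose a * (N - k).choose (j - a) :=
  Nat.mul_pos (Nat.choose_pos h.overlap_le_left) (Nat.choose_pos h.union_le)

lemma choose_mul_choose_le_choose (h : IsOverlap N k j a D) :
    k.choose a * (N - k).choose (j - a) ≤ N.choose j := by
  simpa only [Nat.add_sub_cancel' h.left_le, Nat.add_sub_cancel' h.overlap_le_right]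
    using choose_mul_choose_le k (N - k) a (j - a)

lemma exists_card_le (h : IsOverlap N k j a D) (hN : 0 < N) :
    ∃ B : Finset (Fin N → Fin 2),
      B.card ≤ (N + 1) * (N.choose j / (k.choose a * (N - k).choose (j - a)) : ℝ) ∧
        ∀ s ∈ uncovered B D, s.card < k := by
  have hpos : (0 : ℝ) < k.choose a * (N - k).choose (j - a) := mod_cast h.choose_mul_choose_pos
  set ratio : ℝ := N.choose j / (k.choose a * (N - k).choose (j - a)) with hratio
  have hratio1 : 1 ≤ ratio := (one_le_div hpos).2 (mod_cast h.choose_mul_choose_le_choose)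
  have hn : N * N.choose j ≤ ⌈N * ratio⌉₊ * (k.choose a * (N - k).choose (j - a)) := by
    have hceil := mul_le_mul_of_nonneg_right (Nat.le_ceil (N * ratio)) hpos.le
    rw [hratio, mul_assoc, div_mul_cancel₀ _ hpos.ne', ← hratio] at hceil
    exact_mod_cast hceil
  obtain ⟨B, hB, hcover⟩ := exists_forall_mem_uncovered_card_lt hN h.right_le h.overlap_le_right hn
    h.distortion_le
  refine ⟨B, ?_, hcover⟩
  calc (B.card : ℝ) ≤ ⌈N * ratio⌉₊ := mod_cast hB
    _ ≤ N * ratio + 1 := (Nat.ceil_lt_add_one (by positivity)).le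
    _ ≤ (N + 1) * ratio := by linarith

end IsOverlap

lemma hasSlope_log_overlap_ratio {k j a : ℕ → ℕ} {Dth : ℕ → ℝ} {u β α : ℝ}
    (h : ∀ᶠ N in atTop, IsOverlap N (k N) (j N) (a N) (Dth N)) (hk : HasSlope (fun N => k N) u)
    (hj : HasSlope (fun N => j N) β) (ha : HasSlope (fun N => a N) α) :
    HasSlope (fun N => Real.log ((N + 1) *
      (N.choose (j N) / ((k N).choose (a N) * (N - k N).choose (j N - a N)))))
      (overlapExponent u β α) := by
  have hNk : HasSlope (fun N => (N - k N : ℕ)) (1 - u) :=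
    (HasSlope.natCast.sub hk).congr' (h.mono fun N h => (Nat.cast_sub h.left_le).symm)
  have hja : HasSlope (fun N => (j N - a N : ℕ)) (β - α) :=
    (hj.sub ha).congr' (h.mono fun N h => (Nat.cast_sub h.overlap_le_right).symm)
  have htotal := HasSlope.log_choose (h.mono fun _ h => h.right_le)
    (.of_forall fun _ => le_rfl) .natCast hj
  have hin := HasSlope.log_choose (h.mono fun _ h => h.overlap_le_left)
    (h.mono fun _ h => h.left_le) hk ha
  have hout := HasSlope.log_choose (h.mono fun _ h => h.union_le)
    (.of_forall fun _ => Nat.sub_le _ _) hNk hja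
  have hsum := HasSlope.log_natCast_add_one.add (htotal.sub (hin.add hout))
  rw [zero_add] at hsum
  refine hsum.congr' (h.mono fun N h => ?_)
  have hpos := h.choose_mul_choose_pos
  have htop := Nat.choose_pos h.right_le
  have hin0 : ((k N).choose (a N) : ℝ) ≠ 0 := mod_cast (Nat.pos_of_mul_pos_right hpos).ne'
  have hout0 : ((N - k N).choose (j N - a N) : ℝ) ≠ 0 :=
    mod_cast (Nat.pos_of_mul_pos_left hpos).ne'
  beta_reduce
  rw [Real.log_mul (by positivity) (by positivity), Real.log_div (by positivity) (by positivity),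
    Real.log_mul hin0 hout0]

lemma exists_cover_of_isOverlap {k j a : ℕ → ℕ} {Dth : ℕ → ℝ} {u β α : ℝ}
    (h : ∀ᶠ N in atTop, IsOverlap N (k N) (j N) (a N) (Dth N)) (hk : HasSlope (fun N => k N) u)
    (hj : HasSlope (fun N => j N) β) (ha : HasSlope (fun N => a N) α) :
    ∃ B : ∀ N : ℕ, Finset (Fin N → Fin 2),
      (∀ᶠ N in atTop, ∀ s ∈ uncovered (B N) (Dth N), s.card < k N) ∧
      ∀ R, overlapExponent u β α < R * Real.log 2 →
        ∀ᶠ N : ℕ in atTop, ((B N).card : ℝ) ≤ 2 ^ (N * R) := by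
  choose! B hB using fun N (h : IsOverlap N (k N) (j N) (a N) (Dth N)) => h.exists_card_le
  refine ⟨B, ?_, fun R hR => ?_⟩
  · filter_upwards [h, eventually_gt_atTop 0] with N h hN using (hB N h hN).2
  · have hpos : ∀ᶠ N : ℕ in atTop, 0 < (N + 1) *
        (N.choose (j N) / ((k N).choose (a N) * (N - k N).choose (j N - a N)) : ℝ) := by
      filter_upwards [h] with N h
      have hoverlap : (0 : ℝ) < (k N).choose (a N) * (N - k N).choose (j N - a N) :=
        mod_cast h.choose_mul_choose_pos
      have htop := Nat.choose_pos h.right_le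
      positivity
    filter_upwards [h, eventually_gt_atTop 0,
      eventually_le_two_rpow hpos (hasSlope_log_overlap_ratio h hk hj ha) hR] with N h hN hle
    exact (hB N h hN).1.trans hle

section Parameters

variable {k T : ℕ → ℕ} {Dth : ℕ → ℝ} {t u : ℝ}

lemma exists_isOverlap_of_sub_le (ht0 : 0 ≤ t) (htu : t ≤ u) (hu1 : u < 1) (hs : u - t ≤ 1 - u)
    (hk : HasSlope (fun N => k N) u) (hT : HasSlope (fun N => T N) t)
    (hTk : ∀ᶠ N in atTop, T N ≤ k N) (hDT : ∀ᶠ N : ℕ in atTop, N - Dth N ≤ T N) :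
    ∃ j a : ℕ → ℕ, ∃ β, (∀ᶠ N in atTop, IsOverlap N (k N) (j N) (a N) (Dth N)) ∧
      HasSlope (fun N => j N) β ∧ HasSlope (fun N => a N) (β * (1 - (u - t))) ∧
      u = β * (1 - (u - t)) + (1 - β) * (u - t) := by
  obtain ⟨s, rfl⟩ : ∃ s, u = t + s := ⟨u - t, by ring⟩
  rw [add_sub_cancel_left] at hs ⊢
  obtain ⟨β, hβ0, hβ1, hβ⟩ : ∃ β, 0 ≤ β ∧ β ≤ 1 ∧ β * (1 - 2 * s) = t := by
    refine ⟨t / (1 - 2 * s), div_nonneg ht0 (by linarith),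
      div_le_one_of_le₀ (by linarith) (by linarith), div_mul_cancel_of_imp fun h => ?_⟩
    linarith
  have hkN : ∀ᶠ N in atTop, k N ≤ N := by
    filter_upwards [hk.eventually_lt .natCast hu1] with N h using mod_cast h.le
  have hbound : HasSlope (fun N => (min (k N) (N + T N - k N) : ℕ)) (min (t + s) (1 - s)) := by
    have h := hk.min ((HasSlope.natCast.add hT).sub hk)
    rw [show 1 + t - (t + s) = 1 - s by ring] at h
    refine h.congr' (hkN.mono fun N hN => ?_)
    push_cast [Nat.cast_sub (hN.trans (Nat.le_add_right N (T N)))]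
    rfl
  obtain ⟨a, hTa, ha⟩ := exists_nat_between_hasSlope (α := β * (1 - s))
    (by filter_upwards [hTk, hkN] with N h h' using by lia) hT hbound ht0 (by nlinarith)
    (le_min (by nlinarith) (by nlinarith))
  refine ⟨fun N => 2 * a N - T N, a, β, ?_, ?_, ha, by linarith⟩
  · filter_upwards [hTa, hkN, hDT] with N ⟨hTa, hab⟩ hkN hDT
    have hak : a N ≤ k N := hab.trans (min_le_left _ _)
    have haN : a N ≤ N + T N - k N := hab.trans (min_le_right _ _)
    refine ⟨hak, by lia, by lia, hkN, by lia, ?_⟩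
    push_cast [Nat.cast_sub (show T N ≤ 2 * a N by lia)]
    linarith
  · have hdiff := (ha.const_mul 2).sub hT
    rw [show 2 * (β * (1 - s)) - t = β by linarith] at hdiff
    refine hdiff.congr' (hTa.mono fun N h => ?_)
    push_cast [Nat.cast_sub (show T N ≤ 2 * a N by lia)]
    rfl

lemma eventually_isOverlap_self (hu1 : u < 1) (hs : 1 - u < u - t)
    (hk : HasSlope (fun N => k N) u) (hT : HasSlope (fun N => T N) t)
    (hDT : ∀ᶠ N : ℕ in atTop, N - Dth N ≤ T N) :
    ∀ᶠ N in atTop, IsOverlap N (k N) N (k N) (Dth N) := by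
  have hlt : ∀ᶠ N : ℕ in atTop, (N + T N : ℝ) < 2 * k N :=
    (HasSlope.natCast.add hT).eventually_lt (hk.const_mul 2) (by linarith)
  filter_upwards [hlt, hk.eventually_lt .natCast hu1, hDT] with N hlt hkN hDT
  have hkN' : k N ≤ N := mod_cast hkN.le
  exact ⟨le_rfl, hkN', le_rfl, hkN', le_rfl, by linarith⟩

lemma exists_cover_sequence (ht0 : 0 ≤ t) (htu : t ≤ u) (hu1 : u < 1)
    (hk : HasSlope (fun N => k N) u) (hT : HasSlope (fun N => T N) t)
    (hTk : ∀ᶠ N in atTop, T N ≤ k N) (hDT : ∀ᶠ N : ℕ in atTop, N - Dth N ≤ T N) :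
    ∃ B : ∀ N : ℕ, Finset (Fin N → Fin 2),
      (∀ᶠ N in atTop, ∀ s ∈ uncovered (B N) (Dth N), s.card < k N) ∧
      ∀ ε : ℝ, 0 < ε → ∀ᶠ N : ℕ in atTop,
        ((B N).card : ℝ) ≤ 2 ^ (N * (max (H u - H (u - t)) 0 + ε)) := by
  have hlog2 : 0 < Real.log 2 := Real.log_pos one_lt_two
  suffices hoverlap : ∃ j a : ℕ → ℕ, ∃ β α,
      (∀ᶠ N in atTop, IsOverlap N (k N) (j N) (a N) (Dth N)) ∧
      HasSlope (fun N => j N) β ∧ HasSlope (fun N => a N) α ∧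
      overlapExponent u β α ≤ max (H u - H (u - t)) 0 * Real.log 2 by
    obtain ⟨j, a, β, α, h, hj, ha, hexponent⟩ := hoverlap
    obtain ⟨B, hB, hcard⟩ := exists_cover_of_isOverlap h hk hj ha
    exact ⟨B, hB, fun ε hε => hcard _ (hexponent.trans_lt (by gcongr; linarith))⟩
  rcases le_or_gt (u - t) (1 - u) with hs | hs
  · obtain ⟨j, a, β, h, hj, ha, hu⟩ := exists_isOverlap_of_sub_le ht0 htu hu1 hs hk hT hTk hDT
    refine ⟨j, a, β, _, h, hj, ha, ?_⟩
    have hinfo := overlapExponent_mul_one_sub β (u - t)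
    rw [← hu] at hinfo
    rw [hinfo, ← div_le_iff₀ hlog2, sub_div, ← H_eq_binEntropy_div, ← H_eq_binEntropy_div]
    exact le_max_left _ _
  · refine ⟨fun N => N, k, 1, u, eventually_isOverlap_self hu1 hs hk hT hDT, .natCast, hk, ?_⟩
    rw [overlapExponent_one_self]
    positivity

end Parameters

/-! ### Achievability -/

namespace AchievesExponent

variable {pe f : ℕ → ℝ} {E : ℝ}

lemma of_le (hf : AchievesExponent f E) (hnonneg : ∀ N, 0 ≤ pe N)
    (hle : ∀ᶠ N in atTop, pe N ≤ f N) : AchievesExponent pe E := by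
  refine ⟨squeeze_zero' (.of_forall hnonneg) hle hf.1, fun ε hε => ?_⟩
  filter_upwards [hle, hf.2 ε hε] with N h h' using h.trans h'

lemma of_tendsto_zero (h : Tendsto pe atTop (𝓝 0)) : AchievesExponent pe 0 := by
  refine ⟨h, fun ε hε => ?_⟩
  filter_upwards [h.eventually_le_const one_pos] with N hN
  exact hN.trans (Real.one_le_rpow one_le_two (by nlinarith [N.cast_nonneg (α := ℝ)]))

lemma of_forall_le (hE : 0 < E) (hnonneg : ∀ N, 0 ≤ pe N)
    (h : ∀ ε : ℝ, 0 < ε → ∀ᶠ N : ℕ in atTop, pe N ≤ 2 ^ (-(N * (E - ε)))) :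
    AchievesExponent pe E := by
  refine ⟨?_, h⟩
  have hrate : (2 : ℝ) ^ (-(E / 2)) < 1 :=
    Real.rpow_lt_one_of_one_lt_of_neg one_lt_two (by linarith)
  refine squeeze_zero' (.of_forall hnonneg) ?_
    (tendsto_pow_atTop_nhds_zero_of_lt_one (by positivity) hrate)
  filter_upwards [h (E / 2) (half_pos hE)] with N hN
  rwa [sub_half, ← mul_neg, mul_comm, Real.rpow_mul two_pos.le, Real.rpow_natCast] at hN

end AchievesExponent

lemma hasSlope_rpow_three_quarters : HasSlope (fun N => (N : ℝ) ^ (3 / 4 : ℝ)) 0 := by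
  refine ((tendsto_rpow_neg_atTop (by norm_num : (0 : ℝ) < 1 / 4)).comp
    tendsto_natCast_atTop_atTop).congr' ?_
  filter_upwards [eventually_gt_atTop 0] with N hN
  rw [Function.comp_apply, ← Real.rpow_sub_one (by positivity)]
  norm_num

section LowerTail

variable {p u : ℝ} {k : ℕ → ℕ}

lemma achievesExponent_sum_range_of_lt (h0 : 0 < p) (h1 : p < 1) (hu : 0 ≤ u) (hup : u < p)
    (hk : HasSlope (fun N => k N) u) :
    AchievesExponent (fun N => ∑ i ∈ Finset.range (k N), binomialProb p N i) (klBin u p) := by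
  refine .of_forall_le (klBin_pos h1 hu hup)
    (fun N => Finset.sum_nonneg fun i _ => binomialProb_nonneg h0.le h1.le N i) fun ε hε => ?_
  have hcont : ∀ᶠ v in 𝓝[>] u, klBin u p - ε < klBin v p :=
    ((continuous_klBin h0 h1).continuousAt.eventually_const_lt (by linarith)).filter_mono
      nhdsWithin_le_nhds
  obtain ⟨v, hv, huv, hvp⟩ := (hcont.and (Ioo_mem_nhdsGT hup)).exists
  filter_upwards [hk.eventually_lt (.natCast_mul v) huv] with N hkN
  calc ∑ i ∈ Finset.range (k N), binomialProb p N i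
      ≤ 2 ^ (-(N * klBin v p)) :=
        sum_binomialProb_le_two_rpow h1 (hu.trans_lt huv) hvp.le fun i hi =>
          (Nat.cast_le.2 (Finset.mem_range.1 hi).le).trans hkN.le
    _ ≤ 2 ^ (-(N * (klBin u p - ε))) := by
        gcongr
        exact one_le_two

lemma tendsto_sum_range_binomialProb_zero (h0 : 0 ≤ p) (h1 : p ≤ 1)
    (hk : ∀ᶠ N in atTop, k N ≤ ⌈N * p - (N : ℝ) ^ (3 / 4 : ℝ)⌉₊) :
    Tendsto (fun N => ∑ i ∈ Finset.range (k N), binomialProb p N i) atTop (𝓝 0) := by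
  have hvariance : Tendsto (fun N : ℕ => p * (1 - p) * (N : ℝ) ^ (-(1 / 2) : ℝ)) atTop (𝓝 0) := by
    simpa using ((tendsto_rpow_neg_atTop (by norm_num : (0 : ℝ) < 1 / 2)).comp
      tendsto_natCast_atTop_atTop).const_mul (p * (1 - p))
  refine squeeze_zero'
    (.of_forall fun N => Finset.sum_nonneg fun i _ => binomialProb_nonneg h0 h1 N i) ?_ hvariance
  filter_upwards [hk, eventually_gt_atTop 0] with N hkN hN
  have hN' : (0 : ℝ) < N := mod_cast hN
  refine (sum_binomialProb_le_variance_div h0 h1 (a := (N : ℝ) ^ (3 / 4 : ℝ)) (by positivity)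
    fun i hi => ?_).trans_eq ?_
  · have hi' := Nat.lt_ceil.1 ((Finset.mem_range.1 hi).trans_le hkN)
    exact (by linarith : _ ≤ _).trans (le_abs_self _)
  · have hpow : (N : ℝ) = (N : ℝ) ^ (-(1 / 2) : ℝ) * ((N : ℝ) ^ (3 / 4 : ℝ)) ^ 2 := by
      rw [← Real.rpow_mul_natCast hN'.le, ← Real.rpow_add hN']
      norm_num
    rw [div_eq_iff (by positivity)]
    nth_rewrite 1 [hpow]
    ring

lemma achievesExponent_sum_range (h0 : 0 < p) (h1 : p < 1) (hu : 0 ≤ u) (hup : u ≤ p)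
    (hk : HasSlope (fun N => k N) u)
    (hkp : ∀ᶠ N in atTop, k N ≤ ⌈N * p - (N : ℝ) ^ (3 / 4 : ℝ)⌉₊) :
    AchievesExponent (fun N => ∑ i ∈ Finset.range (k N), binomialProb p N i) (klBin u p) := by
  rcases hup.lt_or_eq with hup | rfl
  · exact achievesExponent_sum_range_of_lt h0 h1 hu hup hk
  · rw [klBin_self h0 h1]
    exact .of_tendsto_zero (tendsto_sum_range_binomialProb_zero h0.le h1.le hkp)

-- The correction `N ^ (3 / 4)` is invisible at linear scale but exceeds the standard deviation, so
-- that the lower tail below `k` still vanishes when `u = p`.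
lemma exists_weight_threshold {t : ℝ} {T : ℕ → ℕ} (ht0 : 0 ≤ t) (htu : t ≤ u) (hup : u ≤ p)
    (htp : t < p) (hT : HasSlope (fun N => T N) t) :
    ∃ k : ℕ → ℕ, HasSlope (fun N => k N) u ∧ (∀ N, T N ≤ k N) ∧
      ∀ᶠ N in atTop, k N ≤ ⌈N * p - (N : ℝ) ^ (3 / 4 : ℝ)⌉₊ := by
  have hline (x : ℝ) : HasSlope (fun N => N * x - (N : ℝ) ^ (3 / 4 : ℝ)) x := by
    simpa using (HasSlope.natCast_mul x).sub hasSlope_rpow_three_quarters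
  refine ⟨fun N => max (T N) ⌈N * u - (N : ℝ) ^ (3 / 4 : ℝ)⌉₊, ?_, fun N => le_max_left _ _, ?_⟩
  · simpa [max_eq_right htu] using hT.max ((hline u).natCeil (ht0.trans htu))
  · filter_upwards [hT.eventually_lt (hline p) htp] with N hN
    exact max_le (Nat.cast_le.1 (hN.le.trans (Nat.le_ceil _))) (by gcongr)

end LowerTail

lemma exists_patterns_achievesExponent
    (A : ℕ → Type*) [∀ N, Fintype (A N)] [∀ N, DecidableEq (A N)] [∀ N, Nontrivial (A N)]
    {p D u : ℝ} {Dth : ℕ → ℝ} (h0 : 0 < p) (h1 : p < 1)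
    (hpm : ∀ N, (1 - p) / ((Fintype.card (A N) : ℝ) - 1) < p) (hDth : HasSlope Dth D)
    (hD0 : 1 - p < D) (hD1 : D ≤ 1) (hu : u ∈ Set.Icc (1 - D) p) :
    ∃ B : ∀ N : ℕ, Finset (Fin N → Fin 2),
      (∀ c : ∀ N : ℕ, Fin N → A N,
        AchievesExponent (fun N => errorProb p (c N) (B N) (Dth N)) (klBin u p)) ∧
      ∀ ε : ℝ, 0 < ε → ∀ᶠ N : ℕ in atTop,
        ((B N).card : ℝ) ≤ 2 ^ (N * (max (H u - H (u + D - 1)) 0 + ε)) := by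
  have ht0 : 0 ≤ 1 - D := by linarith
  have hT : HasSlope (fun N => (⌈N - Dth N⌉₊ : ℝ)) (1 - D) :=
    (HasSlope.natCast.sub hDth).natCeil ht0
  obtain ⟨k, hk, hTk, hkp⟩ := exists_weight_threshold ht0 hu.1 hu.2 (by linarith) hT
  obtain ⟨B, hB, hcard⟩ := exists_cover_sequence ht0 hu.1 (hu.2.trans_lt h1) hk hT
    (.of_forall hTk) (.of_forall fun N => Nat.le_ceil _)
  rw [show u - (1 - D) = u + D - 1 by ring] at hcard
  refine ⟨B, fun c => ?_, hcard⟩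
  refine (achievesExponent_sum_range h0 h1 (ht0.trans hu.1) hu.2 hk hkp).of_le
    (fun N => errorProb_nonneg h0.le h1.le (hpm N) (c N)) ?_
  filter_upwards [hB] with N hB
  exact errorProb_le_sum_binomialProb h0.le h1.le (hpm N) (c N)
    fun s hs => Finset.mem_range.2 (hB s hs)

/-! ### Converse -/

lemma eventually_mul_succ_le_two_rpow {c ε : ℝ} (hc : 0 < c) (hε : 0 < ε) :
    ∀ᶠ N : ℕ in atTop, c * (N + 1) ≤ 2 ^ (N * ε) := by
  have hslope : HasSlope (fun N => Real.log (c * (N + 1))) 0 := by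
    have h := (HasSlope.const (Real.log c)).add HasSlope.log_natCast_add_one
    rw [zero_add] at h
    exact h.congr' (.of_forall fun N => (Real.log_mul hc.ne' (by positivity)).symm)
  exact eventually_le_two_rpow (.of_forall fun N => by positivity) hslope
    (mul_pos hε (Real.log_pos one_lt_two))

lemma lt_half_of_H_lt {u s : ℝ} (hsu : s ≤ u) (hu1 : u ≤ 1) (h : H s < H u) : s < 2⁻¹ := by
  by_contra! hs
  have hanti := Real.binEntropy_strictAntiOn.antitoneOn ⟨hs, hsu.trans hu1⟩ ⟨hs.trans hsu, hu1⟩ hsu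
  rw [H_eq_binEntropy_div, H_eq_binEntropy_div] at h
  exact h.not_ge (by gcongr)

lemma choose_div_two_le_card_slice_uncovered {v D : ℝ} (hv : 0 < v) (hv' : v ≤ 2⁻¹) {N k : ℕ}
    (hkN : k ≤ N) {B : Finset (Fin N → Fin 2)} (hD : D + k - N ≤ N * v)
    (hB : B.card * 2 ^ (N * H v) * (2 * (N + 1)) ≤ (2 : ℝ) ^ (N * H (k / N))) :
    (N.choose k : ℝ) / 2 ≤ ((uncovered B D).slice k).card := by
  have hballs : B.card * 2 ^ (N * H v) ≤ (N.choose k : ℝ) / 2 := by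
    have h := hB.trans (two_rpow_H_le hkN)
    refine le_of_mul_le_mul_right ?_ (by positivity : (0 : ℝ) < 2 * (N + 1))
    linarith
  linarith [choose_sub_le_card_slice_uncovered hv hv' B hD]

lemma exists_choose_div_two_le_card_slice_uncovered {u D ε : ℝ} {Dth : ℕ → ℝ}
    (hs0 : 0 ≤ u + D - 1) (hD1 : D ≤ 1) (hu1 : u ≤ 1) (hR : H (u + D - 1) < H u) (hε : 0 < ε)
    (hDth : HasSlope Dth D) :
    ∃ δ > 0, ∀ᶠ N : ℕ in atTop, ∀ B : Finset (Fin N → Fin 2),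
      B.card < (2 : ℝ) ^ (N * (H u - H (u + D - 1) - ε)) →
      ∀ k ≤ N, |(k : ℝ) / N - u| ≤ δ →
        (N.choose k : ℝ) / 2 ≤ ((uncovered B (Dth N)).slice k).card := by
  set s := u + D - 1
  have hs : s < 2⁻¹ := lt_half_of_H_lt (by linarith) hu1 hR
  obtain ⟨δ₀, hδ₀, hHu⟩ := Metric.eventually_nhds_iff.1
    (continuous_H.continuousAt.eventually_const_lt (by linarith : H u - ε / 4 < H u))
  have hδs : Tendsto (fun δ => s + 2 * δ) (𝓝[>] 0) (𝓝 s) :=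
    tendsto_nhdsWithin_of_tendsto_nhds (by simpa using (Continuous.tendsto (by fun_prop) 0 :
      Tendsto (fun δ => s + 2 * δ) (𝓝 0) (𝓝 (s + 2 * 0))))
  obtain ⟨δ, ⟨hv, hHv⟩, hδ, hδδ₀⟩ := ((hδs.eventually_lt_const hs).and
    (((continuous_H.tendsto s).comp hδs).eventually_lt_const
      (by linarith : H s < H s + ε / 4)) |>.and (Ioo_mem_nhdsGT hδ₀)).exists
  refine ⟨δ, hδ, ?_⟩
  filter_upwards [hDth.eventually_lt (.natCast_mul (D + δ)) (by linarith), eventually_gt_atTop 0,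
    eventually_mul_succ_le_two_rpow two_pos (half_pos hε)] with N hDN hN hpoly B hB k hkN hk
  have hk' : k ≤ N * (u + δ) := by
    rw [← div_le_iff₀' (by positivity)]
    linarith [le_abs_self ((k : ℝ) / N - u)]
  refine choose_div_two_le_card_slice_uncovered (by linarith) hv.le hkN (by linarith) ?_
  calc B.card * 2 ^ (N * H (s + 2 * δ)) * (2 * (N + 1))
      ≤ (2 : ℝ) ^ (N * (H u - H s - ε)) * 2 ^ (N * (H s + ε / 4)) * 2 ^ (N * (ε / 2)) := by
        gcongr
        exacts [one_le_two, hHv.le]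
    _ = 2 ^ (N * (H u - ε / 4)) := by
        rw [← Real.rpow_add two_pos, ← Real.rpow_add two_pos]
        ring_nf
    _ ≤ 2 ^ (N * H (k / N)) := by
        gcongr
        exacts [one_le_two, (hHu (hk.trans_lt hδδ₀)).le]

/-- The weights `k ≤ N` whose relative value `k / N` is within `δ` of `u`. -/
noncomputable def nearWeights (N : ℕ) (u δ : ℝ) : Finset ℕ :=
  {k ∈ Finset.range (N + 1) | |(k : ℝ) / N - u| ≤ δ}

lemma mem_nearWeights {N k : ℕ} {u δ : ℝ} :
    k ∈ nearWeights N u δ ↔ k ≤ N ∧ |(k : ℝ) / N - u| ≤ δ := by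
  rw [nearWeights, Finset.mem_filter, Finset.mem_range_succ_iff]

section NearWeights

variable {p u δ : ℝ} {pe : ℕ → ℝ}

lemma eventually_half_le_sum_nearWeights (h0 : 0 ≤ p) (h1 : p ≤ 1) (hδ : 0 < δ) :
    ∀ᶠ N in atTop, 1 / 2 ≤ ∑ k ∈ nearWeights N p δ, binomialProb p N k := by
  have hlim : HasSlope (fun _ => p * (1 - p) / δ ^ 2) 0 := .const _
  filter_upwards [Tendsto.eventually_le_const one_half_pos hlim, eventually_gt_atTop 0]
    with N hsmall hN
  have hfar : ∑ k ∈ (Finset.range (N + 1)).filter fun k : ℕ => ¬ |(k : ℝ) / N - p| ≤ δ,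
      binomialProb p N k ≤ N * (p * (1 - p)) / (N * δ) ^ 2 := by
    refine sum_binomialProb_le_variance_div h0 h1 (by positivity) fun k hk => ?_
    have hscale : (N : ℝ) * p - k = N * -((k : ℝ) / N - p) := by field_simp; ring
    rw [hscale, abs_mul, abs_neg, Nat.abs_cast]
    gcongr
    exact (not_le.1 (Finset.mem_filter.1 hk).2).le
  have hvariance : N * (p * (1 - p)) / (N * δ) ^ 2 = p * (1 - p) / δ ^ 2 / N := by field_simp
  have htotal := Finset.sum_filter_add_sum_filter_not (Finset.range (N + 1))
    (fun k : ℕ => |(k : ℝ) / N - p| ≤ δ) (binomialProb p N)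
  rw [sum_range_binomialProb] at htotal
  rw [nearWeights]
  linarith

lemma AchievesExponent.eventually_lt_binomialProb_div_two {E v : ℝ} {k : ℕ → ℕ}
    (hpe : AchievesExponent pe E) (h0 : 0 < p) (h1 : p < 1) (hk : HasSlope (fun N => k N) v)
    (hv1 : v < 1) (hvE : klBin v p < E) :
    ∀ᶠ N in atTop, pe N < binomialProb p N (k N) / 2 := by
  obtain ⟨η, hη, hηE⟩ : ∃ η > 0, klBin v p < E - 2 * η :=
    ⟨(E - klBin v p) / 3, by linarith, by linarith⟩
  have hkl : ∀ᶠ N in atTop, klBin (k N / N) p < E - 2 * η :=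
    (((continuous_klBin h0 h1).tendsto v).comp hk).eventually_lt_const hηE
  filter_upwards [hpe.2 η hη, hkl, hk.eventually_lt .natCast hv1, eventually_gt_atTop 0,
    eventually_mul_succ_le_two_rpow two_pos hη] with N hpeN hkl hkN hN hpoly
  have hlt : pe N * (2 * (N + 1)) < (N + 1) * binomialProb p N (k N) := by
    calc pe N * (2 * (N + 1)) ≤ 2 ^ (-(N * (E - η))) * 2 ^ (N * η) := by gcongr
      _ = 2 ^ (-(N * (E - 2 * η))) := by
          rw [← Real.rpow_add two_pos]
          ring_nf
      _ < 2 ^ (-(N * klBin (k N / N) p)) := by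
          exact Real.rpow_lt_rpow_of_exponent_lt one_lt_two (by gcongr)
      _ ≤ (N + 1) * binomialProb p N (k N) := two_rpow_neg_klBin_le h0 h1 (mod_cast hkN.le)
  refine lt_of_mul_lt_mul_right ?_ (by positivity : (0 : ℝ) ≤ 2 * (N + 1))
  linarith

lemma AchievesExponent.eventually_lt_sum_nearWeights_div_two (h0 : 0 < p) (h1 : p < 1)
    (hu : 0 ≤ u) (hup : u ≤ p) (hδ : 0 < δ) (hpe : AchievesExponent pe (klBin u p)) :
    ∀ᶠ N in atTop, pe N < (∑ k ∈ nearWeights N u δ, binomialProb p N k) / 2 := by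
  rcases hup.lt_or_eq with hup | rfl
  · obtain ⟨v, huv, hv⟩ := exists_between (lt_min hup (lt_add_of_pos_right u hδ))
    obtain ⟨hvp, hvδ⟩ := lt_min_iff.1 hv
    have hk : HasSlope (fun N => (⌈N * v⌉₊ : ℝ)) v :=
      (HasSlope.natCast_mul v).natCeil (hu.trans huv.le)
    have hvE : klBin v p < klBin u p :=
      strictAntiOn_klBin h0 h1 ⟨hu, hup.le⟩ ⟨hu.trans huv.le, hvp.le⟩ huv
    filter_upwards [hpe.eventually_lt_binomialProb_div_two h0 h1 hk (hvp.trans h1) hvE,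
      hk.eventually_lt .natCast (hvp.trans h1), Tendsto.eventually_const_lt huv hk,
      Tendsto.eventually_lt_const hvδ hk] with N hlt hkN huk hku
    have hmem : ⌈N * v⌉₊ ∈ nearWeights N u δ :=
      mem_nearWeights.2 ⟨mod_cast hkN.le, abs_le.2 ⟨by linarith, by linarith⟩⟩
    refine hlt.trans_le ?_
    gcongr
    exact Finset.single_le_sum (fun k _ => binomialProb_nonneg h0.le h1.le N k) hmem
  · filter_upwards [eventually_half_le_sum_nearWeights h0.le h1.le hδ,
      hpe.1.eventually_lt_const (by norm_num : (0 : ℝ) < 1 / 4)] with N hnear hsmall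
    linarith

end NearWeights

section Converse

variable {A : ℕ → Type*} [∀ N, Fintype (A N)] [∀ N, DecidableEq (A N)] [∀ N, Nontrivial (A N)]
  {p D : ℝ} {Dth : ℕ → ℝ} {B : ∀ N : ℕ, Finset (Fin N → Fin 2)} {c : ∀ N : ℕ, Fin N → A N}

lemma eventually_nonempty_of_tendsto_errorProb
    (hpm : ∀ N, (1 - p) / ((Fintype.card (A N) : ℝ) - 1) < p)
    (h : Tendsto (fun N => errorProb p (c N) (B N) (Dth N)) atTop (𝓝 0)) :
    ∀ᶠ N in atTop, (B N).Nonempty := by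
  filter_upwards [h.eventually_lt_const one_pos] with N hN
  rw [Finset.nonempty_iff_ne_empty]
  intro hempty
  rw [hempty, errorProb_empty (hpm N)] at hN
  exact hN.false

lemma eventually_two_rpow_le_card_of_achievesExponent {u ε : ℝ} (h0 : 0 < p) (h1 : p < 1)
    (hpm : ∀ N, (1 - p) / ((Fintype.card (A N) : ℝ) - 1) < p) (hDth : HasSlope Dth D)
    (hD1 : D ≤ 1) (hu : u ∈ Set.Icc (1 - D) p)
    (hB : AchievesExponent (fun N => errorProb p (c N) (B N) (Dth N)) (klBin u p)) (hε : 0 < ε) :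
    ∀ᶠ N : ℕ in atTop,
      (2 : ℝ) ^ (N * (max (H u - H (u + D - 1)) 0 - ε)) ≤ (B N).card := by
  have hu0 : 0 ≤ u := by linarith [hu.1]
  rcases le_or_gt (H u - H (u + D - 1)) 0 with hR | hR
  · rw [max_eq_right hR]
    filter_upwards [eventually_nonempty_of_tendsto_errorProb hpm hB.1] with N hne
    calc (2 : ℝ) ^ (N * (0 - ε)) ≤ 1 :=
          Real.rpow_le_one_of_one_le_of_nonpos one_le_two
            (mul_nonpos_of_nonneg_of_nonpos N.cast_nonneg (by linarith))
      _ ≤ (B N).card := mod_cast hne.card_pos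
  · rw [max_eq_left hR.le]
    obtain ⟨δ, hδ, hslice⟩ := exists_choose_div_two_le_card_slice_uncovered
      (by linarith [hu.1]) hD1 (hu.2.trans h1.le) (sub_pos.1 hR) hε hDth
    filter_upwards [hslice, hB.eventually_lt_sum_nearWeights_div_two h0 h1 hu0 hu.2 hδ]
      with N hslice hlt
    by_contra! hcard
    refine hlt.not_ge (sum_binomialProb_div_two_le_errorProb h0.le h1.le (hpm N) (c N)
      fun k hk => ?_)
    exact hslice (B N) hcard k (mem_nearWeights.1 hk).1 (mem_nearWeights.1 hk).2

end Converse

lemma pos_of_symmChannel_error_lt {A : Type*} [Fintype A] [Nontrivial A] {p : ℝ} (h1 : p ≤ 1)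
    (hpm : (1 - p) / ((Fintype.card A : ℝ) - 1) < p) : 0 < p :=
  (div_nonneg (sub_nonneg.2 h1) (sub_nonneg.2 (mod_cast Fintype.card_pos))).trans_lt hpm

end MBM

theorem theorem2_general
    (A : ℕ → Type*) [∀ N, Nontrivial (A N)] [∀ N, Fintype (A N)] [∀ N, DecidableEq (A N)]
    (p : ℝ) (hp1 : p < 1)
    (hpm : ∀ N, (1 - p) / ((Fintype.card (A N) : ℝ) - 1) < p)
    (Dth : ℕ → ℝ) (D : ℝ)
    (hDth : Tendsto (fun N : ℕ => Dth N / (N : ℝ)) atTop (𝓝 D))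
    (hD0 : 1 - p < D) (hD1 : D ≤ 1)
    (E : ℝ) (hE : E ∈ Set.Icc 0 (MBM.klBin (1 - D) p)) :
    Set.BijOn (fun u => MBM.klBin u p) (Set.Icc (1 - D) p)
      (Set.Icc 0 (MBM.klBin (1 - D) p)) ∧
    (∃ B : ∀ N : ℕ, Finset (Fin N → Fin 2),
      (∀ c : ∀ N : ℕ, Fin N → A N,
        MBM.AchievesExponent (fun N => MBM.errorProb p (c N) (B N) (Dth N)) E) ∧
      ∀ ε : ℝ, 0 < ε → ∀ᶠ N : ℕ in atTop,
        ((B N).card : ℝ) ≤ (2 : ℝ) ^ ((N : ℝ) * (MBM.rate D p E + ε))) ∧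
    (∀ (B : ∀ N : ℕ, Finset (Fin N → Fin 2)) (c : ∀ N : ℕ, Fin N → A N),
      MBM.AchievesExponent (fun N => MBM.errorProb p (c N) (B N) (Dth N)) E →
      ∀ ε : ℝ, 0 < ε → ∀ᶠ N : ℕ in atTop,
        (2 : ℝ) ^ ((N : ℝ) * (MBM.rate D p E - ε)) ≤ ((B N).card : ℝ)) := by
  have hp0 : 0 < p := MBM.pos_of_symmChannel_error_lt hp1.le (hpm 0)
  have hu := MBM.gInv_mem hp0 hp1 hD0 hD1 hE
  have hklBin := MBM.klBin_gInv hp0 hp1 hD0 hD1 hE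
  refine ⟨MBM.bijOn_klBin hp0 hp1 hD0 hD1, ?_, fun B c hB ε hε => ?_⟩
  · simpa only [MBM.rate, hklBin] using
      MBM.exists_patterns_achievesExponent A hp0 hp1 hpm hDth hD0 hD1 hu
  · rw [← hklBin] at hB
    exact MBM.eventually_two_rpow_le_card_of_achievesExponent hp0 hp1 hpm hDth hD1 hu hB hε

theorem theorem2
    -- the field `𝔽_m`, which may grow with the block length `N`
    (A : ℕ → Type*) [∀ N, Field (A N)] [∀ N, Fintype (A N)] [∀ N, DecidableEq (A N)]
    (p : ℝ) (hp1 : p < 1)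
    (hpm : ∀ N, (1 - p) / ((Fintype.card (A N) : ℝ) - 1) < p)
    -- distortion threshold `Dth N` at block length `N`, and its value `D` per symbol
    (Dth : ℕ → ℝ) (D : ℝ)
    (hDth : Tendsto (fun N : ℕ => Dth N / (N : ℝ)) atTop (𝓝 D))
    (hD0 : 1 - p < D) (hD1 : D ≤ 1)
    -- exponent per symbol
    (E : ℝ) (hE : E ∈ Set.Icc 0 (MBM.klBin (1 - D) p)) :
    Set.BijOn (fun u => MBM.klBin u p) (Set.Icc (1 - D) p)
      (Set.Icc 0 (MBM.klBin (1 - D) p)) ∧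
    -- `2 ^ (N R)` attempts suffice
    (∃ B : ∀ N : ℕ, Finset (Fin N → Fin 2),
      (∀ c : ∀ N : ℕ, Fin N → A N,
        MBM.AchievesExponent (fun N => MBM.errorProb p (c N) (B N) (Dth N)) E) ∧
      ∀ ε : ℝ, 0 < ε → ∀ᶠ N : ℕ in atTop,
        ((B N).card : ℝ) ≤ (2 : ℝ) ^ ((N : ℝ) * (MBM.rate D p E + ε))) ∧
    -- and fewer do not
    (∀ (B : ∀ N : ℕ, Finset (Fin N → Fin 2)) (c : ∀ N : ℕ, Fin N → A N),
      MBM.AchievesExponent (fun N => MBM.errorProb p (c N) (B N) (Dth N)) E →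
      ∀ ε : ℝ, 0 < ε → ∀ᶠ N : ℕ in atTop,
        (2 : ℝ) ^ ((N : ℝ) * (MBM.rate D p E - ε)) ≤ ((B N).card : ℝ)) :=
  theorem2_general A p hp1 hpm Dth D hDth hD0 hD1 E hE
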